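/- Trees are finite non-empty rooted unordered trees, considered up to isomorphism; $n_T$ is the number of vertices of $T$ and $\mathbf 1$ is the one-vertex tree. The product $A\cdot B$ is obtained by merging the root of a copy of $B$ with each vertex $x$ of $A$, so that all the subtrees of the root of $B$ become new subtrees of $x$. A tree $T$ with $n_T>1$ is mult-prime if $T=A\cdot B$ only when one of the factors is $\mathbf 1$ and the other is $T$. A binary sequence represents $T$ if it has the form $1\,S_1\cdots S_k\,0$, where $S_1,\dots,S_k$ represent the subtrees of the root of $T$, taken in some order (so the sequence has $2n_T$ bits, and $T$ may have several representing sequences). Proposition. Mult-primality of a tree $T$ with $n_T>1$ can be decided in time polynomial in $n_T$, in fact in time $O(n_T^4)$: there are a deterministic Turing machine (with finitely many stacks, finitely many internal states and finite alphabets) and a constant $C$ such that, for every tree $T$ with $n_T>1$ and every binary sequence $w$ representing $T$, the machine started on input $w$ halts after at most $C\,n_T^4$ steps, and its output is the single bit $1$ if $T$ is mult-prime and the single bit $0$ otherwise. -/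

import Mathlib

/-- Finite ordered rooted trees: a root with the list of the subtrees rooted at its children.
Every tree is non-empty. -/
inductive OrderedTree : Type
  | node (subtrees : List OrderedTree) : OrderedTree

namespace OrderedTree

/-- The list of the subtrees of the root. -/
def subtrees : OrderedTree → List OrderedTree
  | node l => l

/-- The number of vertices. -/
def numVertices : OrderedTree → ℕ
  | node l => 1 + (l.map (fun t => numVertices t)).sum

/-- The binary sequence of an ordered tree, with `true` for `1` and `false` for `0`: a tree whose
root has subtrees with sequences `S₁, …, Sₖ` has the sequence `1 S₁ … Sₖ 0`. -/
def code : OrderedTree → List Bool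
  | node l => true :: ((l.map (fun t => code t)).flatten ++ [false])

/-- The product `A · B`: the root of a copy of `B` is merged with each vertex `x` of `A`, so that
all the subtrees of the root of `B` become new subtrees of `x`. -/
def mul : OrderedTree → OrderedTree → OrderedTree
  | node l, b => node (l.map (fun t => mul t b) ++ b.subtrees)

/-- Two ordered trees are the same unordered tree: the least equivalence relation that allows
one to permute the subtrees of the root, and to replace one subtree of the root
by an equivalent one (hence to permute the subtrees of any vertex). -/
inductive Equivalent : OrderedTree → OrderedTree → Prop
  | refl (t : OrderedTree) : Equivalent t t
  | symm {s t : OrderedTree} : Equivalent s t → Equivalent t s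
  | trans {s t u : OrderedTree} : Equivalent s t → Equivalent t u → Equivalent s u
  | perm {l l' : List OrderedTree} : l.Perm l' → Equivalent (node l) (node l')
  | subtree {s t : OrderedTree} (l r : List OrderedTree) :
      Equivalent s t → Equivalent (node (l ++ s :: r)) (node (l ++ t :: r))

instance setoid : Setoid OrderedTree where
  r := Equivalent
  iseqv := ⟨Equivalent.refl, Equivalent.symm, Equivalent.trans⟩

theorem numVertices_eq_of_equivalent {s t : OrderedTree} (h : Equivalent s t) :
    s.numVertices = t.numVertices := by
  induction h with
  | refl => rfl
  | symm _ ih => exact ih.symm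
  | trans _ _ ih₁ ih₂ => exact ih₁.trans ih₂
  | perm h => simp only [numVertices, (h.map _).sum_eq]
  | subtree l r _ ih => simp [numVertices, ih]

theorem mul_equivalent_left {s t : OrderedTree} (b : OrderedTree) (h : Equivalent s t) :
    Equivalent (s.mul b) (t.mul b) := by
  induction h with
  | refl => exact .refl _
  | symm _ ih => exact .symm ih
  | trans _ _ ih₁ ih₂ => exact .trans ih₁ ih₂
  | perm h =>
    simp only [mul]
    exact .perm ((h.map _).append_right _)
  | subtree l r _ ih =>
    simp only [mul, List.map_append, List.map_cons, List.append_assoc, List.cons_append]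
    exact .subtree _ _ ih

theorem node_append_equivalent (l : List OrderedTree) {s t : OrderedTree} (h : Equivalent s t) :
    Equivalent (node (l ++ s.subtrees)) (node (l ++ t.subtrees)) := by
  induction h with
  | refl => exact .refl _
  | symm _ ih => exact .symm ih
  | trans _ _ ih₁ ih₂ => exact .trans ih₁ ih₂
  | perm h => exact .perm (h.append_left _)
  | subtree l' r h _ =>
    simp only [subtrees, ← List.append_assoc]
    exact .subtree _ _ h

theorem node_map_equivalent {f g : OrderedTree → OrderedTree} (l k : List OrderedTree)
    (h : ∀ t ∈ l, Equivalent (f t) (g t)) :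
    Equivalent (node (l.map f ++ k)) (node (l.map g ++ k)) := by
  suffices H : ∀ p : List OrderedTree,
      Equivalent (node (p ++ (l.map f ++ k))) (node (p ++ (l.map g ++ k))) from H []
  induction l with
  | nil => exact fun p => .refl _
  | cons a l ih =>
    intro p
    have h₁ := Equivalent.subtree p (l.map f ++ k) (h a (by simp))
    have h₂ := ih (fun t ht => h t (by simp [ht])) (p ++ [g a])
    simp only [List.append_assoc, List.cons_append, List.nil_append] at h₂
    exact .trans h₁ h₂

theorem mul_equivalent_right (s : OrderedTree) {b c : OrderedTree} (h : Equivalent b c) :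
    Equivalent (s.mul b) (s.mul c) := by
  match s with
  | node l =>
    simp only [mul]
    exact .trans (node_map_equivalent l _ (fun t _ => mul_equivalent_right t h))
      (node_append_equivalent _ h)

end OrderedTree

/-- Finite (non-empty) rooted unordered trees, up to isomorphism. -/
def UnorderedTree : Type := Quotient OrderedTree.setoid

namespace UnorderedTree

/-- The unordered tree underlying an ordered tree. -/
def ofOrdered (t : OrderedTree) : UnorderedTree := Quotient.mk OrderedTree.setoid t

/-- The number of vertices `n_T`. -/
def numVertices (T : UnorderedTree) : ℕ :=
  Quotient.lift OrderedTree.numVertices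
    (fun _ _ h => OrderedTree.numVertices_eq_of_equivalent h) T

/-- The tree `1` with exactly one vertex. -/
instance : One UnorderedTree := ⟨ofOrdered (.node [])⟩

/-- The product `A · B` of unordered trees. -/
instance : Mul UnorderedTree :=
  ⟨Quotient.map₂ OrderedTree.mul (fun _ t h _ _ h' =>
    OrderedTree.Equivalent.trans (OrderedTree.mul_equivalent_left _ h) (OrderedTree.mul_equivalent_right t h'))⟩

/-- `T` is mult-prime: it is a product of two trees only if the factors are `1` and `T`. -/
def MultPrime (T : UnorderedTree) : Prop :=
  ∀ A B : UnorderedTree, T = A * B → (A = 1 ∧ B = T) ∨ (A = T ∧ B = 1)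

/-- The binary sequence `w` represents `T`: it is the sequence of `T` for some choice of the order
of the subtrees at each vertex. -/
def IsRepresentedBy (T : UnorderedTree) (w : List Bool) : Prop :=
  ∃ t : OrderedTree, ofOrdered t = T ∧ t.code = w

end UnorderedTree

/-! The idea is to choose a canonical order of siblings in which a product becomes a substitution on
codes. Siblings are sorted recursively by `key`, an injective numbering of ordered trees under which
a tree with fewer vertices always has the smaller number. In `A · B`, every subtree of the root of
`B` has fewer vertices than `B`, while every `t · B` has at least as many. So in the sorted form of
`A · B` the subtrees of `B` stand first at each vertex of `A` (`canon_mul`). Hence the code of the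
sorted product is the code of some ordering of `A` with each `1` replaced by `1 f`, where `f` is the
concatenation of the codes of the subtrees of the sorted `B` (`code_mulFront`).

Conversely, codes are uniquely decodable, so a forest code in the image of this substitution comes
from a product (`exists_of_codes_eq_expand`). Thus `T` fails to be mult-prime exactly when the list
of root subtrees of its canonical form splits as `b ++ r`, with both parts nonempty, and the code of
`r`, closed by `0`, lies in the image of `expand (codes b)` (`not_multPrime_iff`). There are fewer
splits than vertices, and each is tested by one left-to-right scan, because every `1` of a word in
the image must be followed by a copy of `codes b`.

The algorithm is a structured program on eight stacks, with a big-step semantics `Run` that carries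
step bounds; `exists_iterate_of_run` transfers these bounds to the compiled machine. With `N = 2 n`,
canonicalization inserts at most `N` trees, each past at most `N` siblings at cost `O(N)`. The
factor tests are at most `N` scans of cost `O(N ^ 2)`. The total is cubic (`run_decidePrime`), which
is stronger than the quartic bound required. -/

/-! ### Bijective base-two numeration -/

/-- The number with bijective base-two digits `l`, the least significant first; `false` is the
digit `1` and `true` is the digit `2`. -/
def bijNum : List Bool → ℕ
  | [] => 0
  | b :: l => 1 + b.toNat + 2 * bijNum l

theorem bijNum_injective : Function.Injective bijNum := by
  intro l
  induction l with
  | nil =>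
    rintro (_ | ⟨b, m⟩) h
    · rfl
    · simp only [bijNum] at h; omega
  | cons a l ih =>
    rintro (_ | ⟨b, m⟩) h
    · simp [bijNum] at h
    · cases a <;> cases b <;> simp [bijNum] at h ⊢
      · exact ih (by omega)
      · omega
      · omega
      · exact ih (by omega)

/-- With `bijNum_lt_two_pow`, this confines the numbers of the words of length `k` to the interval
from `2 ^ k - 1` to `2 ^ (k + 1) - 2`. These intervals are disjoint and increasing, so longer words
have larger numbers. -/
theorem two_pow_le_bijNum (l : List Bool) : 2 ^ l.length ≤ bijNum l + 1 := by
  induction l with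
  | nil => simp [bijNum]
  | cons b l ih => simp only [bijNum, List.length_cons, pow_succ]; omega

theorem bijNum_lt_two_pow (l : List Bool) : bijNum l + 1 < 2 ^ (l.length + 1) := by
  induction l with
  | nil => simp [bijNum]
  | cons b l ih =>
    have := Bool.toNat_le b
    simp only [bijNum, List.length_cons, pow_succ] at ih ⊢; omega

theorem bijNum_lt_of_length_lt {l m : List Bool} (h : l.length < m.length) :
    bijNum l < bijNum m := by
  have h₁ := bijNum_lt_two_pow l
  have h₂ := two_pow_le_bijNum m
  have h₃ : 2 ^ (l.length + 1) ≤ 2 ^ m.length := Nat.pow_le_pow_right (by norm_num) h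
  omega

/-! ### Codes of forests and their unique decoding -/

namespace OrderedTree

theorem tree_induction {P : OrderedTree → Prop} (h : ∀ l, (∀ t ∈ l, P t) → P (node l)) :
    ∀ t, P t
  | node l => h l (fun t _ => tree_induction h t)

/-- The concatenation of the codes of the trees of a forest. -/
def codes (l : List OrderedTree) : List Bool := (l.map code).flatten

@[simp] theorem codes_nil : codes [] = [] := rfl

@[simp] theorem codes_cons (t : OrderedTree) (l : List OrderedTree) :
    codes (t :: l) = t.code ++ codes l := rfl

@[simp] theorem codes_append (l m : List OrderedTree) : codes (l ++ m) = codes l ++ codes m := by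
  simp [codes]

theorem code_node (l : List OrderedTree) : (node l).code = true :: (codes l ++ [false]) := by
  simp [code, codes]

@[simp] theorem node_subtrees (t : OrderedTree) : node t.subtrees = t := by cases t; rfl

theorem code_ne_nil (t : OrderedTree) : t.code ≠ [] := by
  cases t; simp [code_node]

theorem length_codes_of_perm {l m : List OrderedTree} (h : l.Perm m) :
    (codes l).length = (codes m).length := by
  simpa [codes] using ((h.map code).map List.length).sum_eq

theorem length_code (t : OrderedTree) : t.code.length = 2 * t.numVertices := by
  induction t using tree_induction with
  | h l ih =>
    have : (codes l).length = 2 * (l.map numVertices).sum := by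
      induction l with
      | nil => rfl
      | cons a l ih' =>
        simp only [codes_cons, List.length_append, List.map_cons, List.sum_cons]
        rw [ih a (by simp), ih' (fun t ht => ih t (by simp [ht]))]; ring
    simp only [code_node, List.length_cons, List.length_append, this, List.length_nil,
      numVertices]
    ring

theorem length_le_length_codes (l : List OrderedTree) : l.length ≤ (codes l).length := by
  induction l with
  | nil => simp
  | cons t l ih =>
    have := List.length_pos_of_ne_nil (code_ne_nil t)
    simp; omega

/-- Every code starts with `1`, so a `0` in front position can only mean that the forest has ended.
The induction is on length because it descends both into the children of the first tree and into its
siblings. -/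
theorem codes_append_false_inj (l : List OrderedTree) :
    ∀ (m : List OrderedTree) (x y : List Bool),
      codes l ++ false :: x = codes m ++ false :: y → l = m ∧ x = y := by
  suffices H : ∀ n, ∀ l : List OrderedTree, (codes l).length ≤ n →
      ∀ (m : List OrderedTree) (x y : List Bool),
      codes l ++ false :: x = codes m ++ false :: y → l = m ∧ x = y from H _ l le_rfl
  intro n
  induction n with
  | zero =>
    rintro (_ | ⟨⟨l'⟩, l⟩) hl m x y h
    · rcases m with _ | ⟨⟨m'⟩, m⟩ <;> simp_all [code_node]
    · simp [code_node] at hl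
  | succ n ih =>
    rintro (_ | ⟨⟨l'⟩, l⟩) hl m x y h
    · rcases m with _ | ⟨⟨m'⟩, m⟩ <;> simp_all [code_node]
    · rcases m with _ | ⟨⟨m'⟩, m⟩
      · simp [code_node] at h
      · simp [code_node] at h hl
        obtain ⟨rfl, h₁⟩ := ih l' (by omega) _ _ _ h
        obtain ⟨rfl, h₂⟩ := ih l (by omega) _ _ _ h₁
        exact ⟨rfl, h₂⟩

theorem code_append_inj {s t : OrderedTree} {x y : List Bool}
    (h : s.code ++ x = t.code ++ y) : s = t ∧ x = y := by
  cases s; cases t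
  simp only [code_node, List.cons_append, List.append_assoc, List.nil_append, List.cons.injEq,
    true_and] at h
  simpa using codes_append_false_inj _ _ _ _ h

theorem code_injective : Function.Injective code := fun s t h =>
  (code_append_inj (x := []) (y := []) (by simpa using h)).1

/-! ### Sorting by keys and canonical forms -/

/-- An injective numbering of the ordered trees, monotone in the number of vertices. -/
def key (t : OrderedTree) : ℕ := bijNum t.code.reverse

theorem key_injective : Function.Injective key := fun _ _ h =>
  code_injective (List.reverse_injective (bijNum_injective h))

theorem key_lt_of_numVertices_lt {s t : OrderedTree} (h : s.numVertices < t.numVertices) :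
    s.key < t.key :=
  bijNum_lt_of_length_lt (by simp only [List.length_reverse, length_code]; omega)

/-- One pass of bubble sort, which carries the tree of larger key to the right. -/
def bubble (t : OrderedTree) : List OrderedTree → List OrderedTree
  | [] => [t]
  | s :: l => if t.key < s.key then t :: bubble s l else s :: bubble t l

theorem bubble_perm (t : OrderedTree) (l : List OrderedTree) : (bubble t l).Perm (t :: l) := by
  induction l generalizing t with
  | nil => simp [bubble]
  | cons s l ih =>
    simp only [bubble]
    split_ifs
    · exact (ih s).cons t
    · exact ((ih t).cons s).trans (.swap _ _ _)

theorem bubble_pairwise (t : OrderedTree) (l : List OrderedTree)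
    (h : l.Pairwise (fun a b => a.key ≤ b.key)) :
    (bubble t l).Pairwise (fun a b => a.key ≤ b.key) := by
  induction l generalizing t with
  | nil => simp [bubble]
  | cons s l ih =>
    simp only [List.pairwise_cons] at h
    simp only [bubble]
    split_ifs with hts
    · refine List.pairwise_cons.2 ⟨fun a ha => ?_, ih s h.2⟩
      rcases List.mem_cons.1 ((bubble_perm s l).mem_iff.1 ha) with rfl | ha
      · exact hts.le
      · exact hts.le.trans (h.1 a ha)
    · refine List.pairwise_cons.2 ⟨fun a ha => ?_, ih t h.2⟩
      rcases List.mem_cons.1 ((bubble_perm t l).mem_iff.1 ha) with rfl | ha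
      · omega
      · exact h.1 a ha

/-- Sorting of a forest by increasing keys. -/
def bubbleSort (l : List OrderedTree) : List OrderedTree := l.foldr bubble []

theorem bubbleSort_perm (l : List OrderedTree) : (bubbleSort l).Perm l := by
  induction l with
  | nil => simp [bubbleSort]
  | cons t l ih => exact (bubble_perm t _).trans (ih.cons t)

theorem bubbleSort_pairwise (l : List OrderedTree) :
    (bubbleSort l).Pairwise (fun a b => a.key ≤ b.key) := by
  induction l with
  | nil => simp [bubbleSort]
  | cons t l ih => exact bubble_pairwise t _ ih

theorem eq_of_perm_of_pairwise_key {l m : List OrderedTree} (h : l.Perm m)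
    (hl : l.Pairwise (fun a b => a.key ≤ b.key)) (hm : m.Pairwise (fun a b => a.key ≤ b.key)) :
    l = m :=
  List.Perm.eq_of_pairwise (fun _ _ _ _ h₁ h₂ => key_injective (le_antisymm h₁ h₂)) hl hm h

theorem bubbleSort_eq_of_perm {l m : List OrderedTree} (h : l.Perm m) :
    bubbleSort l = bubbleSort m :=
  eq_of_perm_of_pairwise_key ((bubbleSort_perm l).trans (h.trans (bubbleSort_perm m).symm))
    (bubbleSort_pairwise l) (bubbleSort_pairwise m)

/-- The canonical ordering of a tree, with sorted siblings. -/
def canon : OrderedTree → OrderedTree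
  | node l => node (bubbleSort (l.map (fun t => canon t)))

theorem canon_node (l : List OrderedTree) : canon (node l) = node (bubbleSort (l.map canon)) := by
  simp [canon]

theorem canon_equivalent (t : OrderedTree) : Equivalent (canon t) t := by
  induction t using tree_induction with
  | h l ih =>
    rw [canon_node]
    refine .trans (.perm (bubbleSort_perm _)) ?_
    simpa using node_map_equivalent (f := canon) (g := id) l [] ih

/-- Injectivity of `key` makes the sorted arrangement of a forest unique, so permuting siblings has
no effect after sorting. -/
theorem canon_eq_of_equivalent {s t : OrderedTree} (h : Equivalent s t) : canon s = canon t := by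
  induction h with
  | refl => rfl
  | symm _ ih => exact ih.symm
  | trans _ _ ih₁ ih₂ => exact ih₁.trans ih₂
  | perm h => rw [canon_node, canon_node, bubbleSort_eq_of_perm (h.map canon)]
  | subtree l r _ ih => simp [canon_node, ih]

theorem numVertices_canon (t : OrderedTree) : (canon t).numVertices = t.numVertices :=
  numVertices_eq_of_equivalent (canon_equivalent t)

/-! ### Products as substitutions on codes -/

/-- The product with the subtrees of the root of the second factor in front. -/
def mulFront : OrderedTree → OrderedTree → OrderedTree
  | node l, b => node (b.subtrees ++ l.map (fun t => mulFront t b))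

theorem mulFront_node (l : List OrderedTree) (b : OrderedTree) :
    mulFront (node l) b = node (b.subtrees ++ l.map (mulFront · b)) := by
  simp [mulFront]

theorem mul_node (l : List OrderedTree) (b : OrderedTree) :
    mul (node l) b = node (l.map (mul · b) ++ b.subtrees) := by
  simp [mul]

theorem mulFront_equivalent (a b : OrderedTree) : Equivalent (mulFront a b) (mul a b) := by
  induction a using tree_induction with
  | h l ih =>
    rw [mulFront_node, mul_node]
    exact .trans (.perm List.perm_append_comm) (node_map_equivalent l _ ih)

theorem numVertices_le_numVertices_mul (a b : OrderedTree) :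
    b.numVertices ≤ (mul a b).numVertices := by
  cases a; cases b
  simp [mul_node, numVertices, subtrees]

theorem numVertices_lt_of_mem_subtrees {s t : OrderedTree} (h : s ∈ t.subtrees) :
    s.numVertices < t.numVertices := by
  cases t
  have := List.le_sum_of_mem (List.mem_map_of_mem (f := numVertices) h)
  simp only [numVertices, subtrees] at *
  exact Nat.lt_one_add_iff.2 this

/-- A subtree of the root of `canon b` has fewer vertices than `b`, hence fewer than any product `u
· b`, and so a smaller key. Putting the subtrees of `canon b` before the sorted products therefore
gives a sorted list, and sorted lists are unique. The ordering `l` of the first factor is left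
unspecified; its length serves to recognize a trivial first factor. -/
theorem canon_mul (a b : OrderedTree) :
    ∃ l : List OrderedTree, l.length = a.subtrees.length ∧
      canon (mul a b) = mulFront (node l) (canon b) := by
  induction a using tree_induction with
  | h l ih =>
    have ih' : ∀ t ∈ l, ∃ t', canon (mul t b) = mulFront t' (canon b) := fun t ht =>
      let ⟨m, _, h⟩ := ih t ht; ⟨node m, h⟩
    choose! g hg using ih'
    set q := bubbleSort (l.map (fun t => canon (mul t b))) with hq
    have hqp : q.Perm (l.map (fun t => canon (mul t b))) := bubbleSort_perm _
    have hmem : ∀ t ∈ q, ∃ t', mulFront t' (canon b) = t := by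
      intro t ht
      obtain ⟨s, hs, rfl⟩ := List.mem_map.1 (hqp.mem_iff.1 ht)
      exact ⟨g s, (hg s hs).symm⟩
    obtain ⟨m, hm⟩ : ∃ m : List OrderedTree, m.map (mulFront · (canon b)) = q := by
      clear_value q
      clear hq hqp
      induction q with
      | nil => exact ⟨[], rfl⟩
      | cons t q ihq =>
        obtain ⟨m, hm⟩ := ihq (fun s hs => hmem s (by simp [hs]))
        obtain ⟨t', ht'⟩ := hmem t (by simp)
        exact ⟨t' :: m, by simp [hm, ht']⟩
    refine ⟨m, ?_, ?_⟩
    · have := hqp.length_eq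
      rw [← hm] at this
      simpa [subtrees] using this
    · rw [mul_node, mulFront_node, canon_node, hm]
      congr 1
      have hb : (canon b).subtrees = bubbleSort (b.subtrees.map canon) := by
        cases b; simp [canon_node, subtrees]
      refine eq_of_perm_of_pairwise_key ?_ (bubbleSort_pairwise _) ?_
      · refine (bubbleSort_perm _).trans ?_
        rw [List.map_append, List.map_map, hb]
        exact List.perm_append_comm.trans ((bubbleSort_perm _).symm.append hqp.symm)
      · rw [List.pairwise_append]
        refine ⟨hb ▸ bubbleSort_pairwise _, bubbleSort_pairwise _, fun s hs t ht => ?_⟩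
        obtain ⟨u, _, rfl⟩ := List.mem_map.1 (hqp.mem_iff.1 ht)
        refine (key_lt_of_numVertices_lt ?_).le
        have h₁ := numVertices_lt_of_mem_subtrees hs
        have h₂ := numVertices_le_numVertices_mul u b
        rw [numVertices_canon] at h₁ ⊢
        omega

/-- The substitution of `1 f` for `1`, which turns the code of `A` into the code of `A · B`, where
`1 f 0` is the code of `B`. -/
def expand (f : List Bool) : List Bool → List Bool
  | [] => []
  | true :: u => true :: (f ++ expand f u)
  | false :: u => false :: expand f u

theorem expand_append (f u v : List Bool) : expand f (u ++ v) = expand f u ++ expand f v := by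
  induction u with
  | nil => rfl
  | cons b u ih => cases b <;> simp [expand, ih]

/-- The inserted subtrees directly follow the opening `1` of each vertex; this is the reason for
placing them in front. -/
theorem code_mulFront (a b : OrderedTree) :
    (mulFront a b).code = expand (codes b.subtrees) a.code := by
  induction a using tree_induction with
  | h l ih =>
    have : codes (l.map (mulFront · b)) = expand (codes b.subtrees) (codes l) := by
      induction l with
      | nil => rfl
      | cons t l ih' =>
        simp only [List.map_cons, codes_cons, expand_append]
        rw [ih t (by simp), ih' (fun t ht => ih t (by simp [ht]))]
    simp [mulFront_node, code_node, expand, expand_append, this]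

/-- Decoding is unique, and the `0` after `codes s` prevents `s` from running out before `b` does,
since no code starts with `0`. -/
theorem codes_prefix (b : List OrderedTree) :
    ∀ (s : List OrderedTree) (x y : List Bool), codes s ++ false :: x = codes b ++ y →
      ∃ s', s = b ++ s' := by
  induction b with
  | nil => exact fun s _ _ _ => ⟨s, rfl⟩
  | cons t b ih =>
    rintro (_ | ⟨r, s⟩) x y h
    · cases t; simp [code_node] at h
    · simp only [codes_cons, List.append_assoc] at h
      obtain ⟨rfl, h₁⟩ := code_append_inj h
      obtain ⟨s', rfl⟩ := ih s x y h₁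
      exact ⟨s', rfl⟩

/-- Each `1` of the word arises from a `1` of `u`, so it is followed by `codes b`; by `codes_prefix`
the children of that vertex are `b` followed by a forest that is decoded in the same way. The
remainder `z` is kept in the image so that decoding can resume with the siblings. -/
theorem exists_of_codes_eq_expand (b : List OrderedTree) (n : ℕ) :
    ∀ (r : List OrderedTree) (z u : List Bool), (codes r).length ≤ n →
      codes r ++ false :: z = expand (codes b) u →
      ∃ l : List OrderedTree, r = l.map (mulFront · (node b)) ∧
        ∃ u', z = expand (codes b) u' := by
  induction n with
  | zero =>
    rintro (_ | ⟨⟨s⟩, r⟩) z u hn h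
    · rcases u with _ | ⟨_ | _, u⟩ <;> simp [expand] at h
      exact ⟨[], rfl, u, h⟩
    · simp [code_node] at hn
  | succ n ih =>
    rintro (_ | ⟨⟨s⟩, r⟩) z u hn h
    · rcases u with _ | ⟨_ | _, u⟩ <;> simp [expand] at h
      exact ⟨[], rfl, u, h⟩
    · rcases u with _ | ⟨_ | _, u⟩ <;> simp [expand, code_node] at h hn
      obtain ⟨s', rfl⟩ := codes_prefix b s _ _ h
      simp only [codes_append, List.append_assoc, List.append_cancel_left_eq,
        List.length_append] at h hn
      obtain ⟨l₁, rfl, u₁, hu₁⟩ := ih s' _ u (by omega) h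
      obtain ⟨l₂, rfl, u₂, hu₂⟩ := ih r z u₁ (by omega) hu₁
      exact ⟨node l₁ :: l₂, by simp [mulFront_node, subtrees], u₂, hu₂⟩

theorem eq_node_nil_of_equivalent {t : OrderedTree} (h : Equivalent t (node [])) :
    t = node [] := by
  have := numVertices_eq_of_equivalent h
  rcases t with ⟨_ | ⟨⟨s⟩, l⟩⟩
  · rfl
  · simp [numVertices] at this

theorem node_nil_mul (b : OrderedTree) : mul (node []) b = b := by simp [mul_node]

theorem mul_node_nil (a : OrderedTree) : mul a (node []) = a := by
  induction a using tree_induction with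
  | h l ih =>
    simp only [mul_node, subtrees, List.append_nil, node.injEq]
    conv_rhs => rw [← List.map_id l]
    exact List.map_congr_left ih

end OrderedTree

/-! ### The criterion for mult-primality -/

namespace UnorderedTree

open OrderedTree

theorem ofOrdered_eq_iff {s t : OrderedTree} : ofOrdered s = ofOrdered t ↔ Equivalent s t :=
  Quotient.eq (r := OrderedTree.setoid)

theorem ofOrdered_mul (a b : OrderedTree) :
    ofOrdered (a.mul b) = ofOrdered a * ofOrdered b := rfl

theorem one_eq_ofOrdered : (1 : UnorderedTree) = ofOrdered (node []) := rfl

/-- Here `b` lists the subtrees of the right factor, and `r` those that come from the subtrees of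
the left factor. The two nonemptiness conditions say that neither factor is the one-vertex tree. -/
theorem not_multPrime_iff (t : OrderedTree) :
    ¬ (ofOrdered t).MultPrime ↔ ∃ b r : List OrderedTree, b ≠ [] ∧ r ≠ [] ∧
      (canon t).subtrees = b ++ r ∧ ∃ u, codes r ++ [false] = expand (codes b) u := by
  constructor
  · intro h
    simp only [MultPrime, not_forall] at h
    obtain ⟨A, B, hT, hAB⟩ := h
    obtain ⟨a, rfl⟩ : ∃ a, ofOrdered a = A := Quotient.exists_rep A
    obtain ⟨b, rfl⟩ : ∃ b, ofOrdered b = B := Quotient.exists_rep B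
    have hc : canon t = canon (a.mul b) :=
      canon_eq_of_equivalent (ofOrdered_eq_iff.1 (hT.trans (ofOrdered_mul a b).symm))
    obtain ⟨l, hl, hcm⟩ := canon_mul a b
    refine ⟨(canon b).subtrees, l.map (mulFront · (canon b)), fun hb => hAB ?_, fun ha => hAB ?_,
      ?_, codes l ++ [false], ?_⟩
    · have hb' : b = node [] := by
        apply eq_node_nil_of_equivalent
        rw [← hb, node_subtrees]
        exact .symm (canon_equivalent b)
      subst hb'
      rw [← ofOrdered_mul, mul_node_nil] at hT
      exact Or.inr ⟨hT.symm, rfl⟩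
    · have ha' : a = node [] := by
        rw [List.map_eq_nil_iff] at ha
        subst ha
        rw [← node_subtrees a, List.length_eq_zero_iff.1 hl.symm]
      subst ha'
      rw [← ofOrdered_mul, node_nil_mul] at hT
      exact Or.inl ⟨rfl, hT.symm⟩
    · rw [hc, hcm, mulFront_node]; rfl
    · have := code_mulFront (node l) (canon b)
      rw [mulFront_node, code_node, code_node] at this
      simpa [expand] using this
  · rintro ⟨b, r, hb, hr, ht, u, hu⟩ hp
    obtain ⟨l, rfl, -⟩ := exists_of_codes_eq_expand b _ r [] u le_rfl hu
    have hT : ofOrdered t = ofOrdered (node l) * ofOrdered (node b) := by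
      rw [← ofOrdered_mul, ofOrdered_eq_iff]
      refine .trans (.symm (canon_equivalent t)) ?_
      rw [← node_subtrees (canon t), ht]
      have := mulFront_equivalent (node l) (node b)
      rwa [mulFront_node] at this
    rcases hp _ _ hT with ⟨h, -⟩ | ⟨-, h⟩
    · rw [one_eq_ofOrdered, ofOrdered_eq_iff] at h
      have := eq_node_nil_of_equivalent h
      simp_all
    · rw [one_eq_ofOrdered, ofOrdered_eq_iff] at h
      have := eq_node_nil_of_equivalent h
      simp_all

end UnorderedTree

/-! ### Structured stack programs and their compilation -/

/-- Structured programs that act on finitely many stacks of bits, indexed by `K`, and on a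
register with values in `σ`. -/
inductive StackProg (K σ : Type) : Type
  | push (k : K) (f : σ → Bool)
  | peek (k : K) (f : σ → Option Bool → σ)
  | pop (k : K) (f : σ → Option Bool → σ)
  | load (f : σ → σ)
  | seq (p q : StackProg K σ)
  | ite (c : σ → Bool) (p q : StackProg K σ)
  | loop (c : σ → Bool) (p : StackProg K σ)

namespace StackProg

open Turing Function

variable {K σ : Type}

/-- The program locations of a structured program. -/
def Loc : StackProg K σ → Type
  | push _ _ => Unit
  | peek _ _ => Unit
  | pop _ _ => Unit
  | load _ => Unit
  | seq p q => p.Loc ⊕ q.Loc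
  | ite _ p q => Option (p.Loc ⊕ q.Loc)
  | loop _ p => Option p.Loc

theorem finite_loc (p : StackProg K σ) : Finite p.Loc := by
  induction p with
  | push | peek | pop | load => exact inferInstanceAs (Finite Unit)
  | seq p q _ _ => exact inferInstanceAs (Finite (p.Loc ⊕ q.Loc))
  | ite _ p q _ _ => exact inferInstanceAs (Finite (Option (p.Loc ⊕ q.Loc)))
  | loop _ p _ => exact inferInstanceAs (Finite (Option p.Loc))

/-- The location where a program starts. -/
def entry : (p : StackProg K σ) → p.Loc
  | push _ _ => ()
  | peek _ _ => ()
  | pop _ _ => ()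
  | load _ => ()
  | seq p _ => Sum.inl p.entry
  | ite _ _ _ => none
  | loop _ _ => none

/-- The statement at a location of a program whose locations are embedded by `e` into the labels
of a machine, and which continues at the label `x`. -/
def compile {Λ : Type} : (p : StackProg K σ) → (e : p.Loc → Λ) → (x : Λ) → p.Loc →
    TM2.Stmt (fun _ : K => Bool) Λ σ
  | push k f, _, x, _ => .push k f (.goto fun _ => x)
  | peek k f, _, x, _ => .peek k f (.goto fun _ => x)
  | pop k f, _, x, _ => .pop k f (.goto fun _ => x)
  | load f, _, x, _ => .load f (.goto fun _ => x)
  | seq p q, e, _, Sum.inl l => compile p (e ∘ Sum.inl) (e (Sum.inr q.entry)) l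
  | seq _ q, e, x, Sum.inr l => compile q (e ∘ Sum.inr) x l
  | ite c p q, e, _, none =>
    .branch c (.goto fun _ => e (some (Sum.inl p.entry))) (.goto fun _ => e (some (Sum.inr q.entry)))
  | ite _ p _, e, x, some (Sum.inl l) => compile p (e ∘ some ∘ Sum.inl) x l
  | ite _ _ q, e, x, some (Sum.inr l) => compile q (e ∘ some ∘ Sum.inr) x l
  | loop c p, e, x, none => .branch c (.goto fun _ => e (some p.entry)) (.goto fun _ => x)
  | loop _ p, e, _, some l => compile p (e ∘ some) (e none) l

variable [DecidableEq K]

/-- `Run p v S v' S' n`: the program `p`, started with register `v` and stacks `S`, ends with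
register `v'` and stacks `S'` after at most `n` steps. -/
inductive Run : StackProg K σ → σ → (K → List Bool) → σ → (K → List Bool) → ℕ → Prop
  | push (k f v S) : Run (push k f) v S v (update S k (f v :: S k)) 1
  | peek (k f v S) : Run (peek k f) v S (f v (S k).head?) S 1
  | pop (k f v S) : Run (pop k f) v S (f v (S k).head?) (update S k (S k).tail) 1
  | load (f v S) : Run (load f) v S (f v) S 1
  | seq {p q v S v₁ S₁ v₂ S₂ m n} : Run p v S v₁ S₁ m → Run q v₁ S₁ v₂ S₂ n →
      Run (seq p q) v S v₂ S₂ (m + n)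
  | ite_true {c p q v S v₁ S₁ m} : c v = true → Run p v S v₁ S₁ m →
      Run (ite c p q) v S v₁ S₁ (m + 1)
  | ite_false {c p q v S v₁ S₁ m} : c v = false → Run q v S v₁ S₁ m →
      Run (ite c p q) v S v₁ S₁ (m + 1)
  | loop_false {c p v S} : c v = false → Run (loop c p) v S v S 1
  | loop_true {c p v S v₁ S₁ v₂ S₂ m n} : c v = true → Run p v S v₁ S₁ m →
      Run (loop c p) v₁ S₁ v₂ S₂ n → Run (loop c p) v S v₂ S₂ (m + 1 + n)
  | mono {p v S v₁ S₁ m n} : Run p v S v₁ S₁ m → m ≤ n → Run p v S v₁ S₁ n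

/-- Induction on the run: each atomic statement or test is one machine step, and compound programs
concatenate runs. Arbitrary `e` and `x` let the induction reach subprograms embedded in a larger
machine. -/
theorem exists_iterate_of_run {Λ : Type} (M : Λ → TM2.Stmt (fun _ : K => Bool) Λ σ)
    {p : StackProg K σ} {v v' : σ} {S S' : K → List Bool} {n : ℕ} (h : Run p v S v' S' n)
    (e : p.Loc → Λ) (x : Λ) (hM : ∀ l, M (e l) = compile p e x l) :
    ∃ m ≤ n, (flip bind (TM2.step M))^[m] (some ⟨some (e p.entry), v, S⟩) =
      some ⟨some x, v', S'⟩ := by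
  have one : ∀ {l : Λ} {v : σ} {S : K → List Bool} {c : TM2.Cfg (fun _ : K => Bool) Λ σ} {n : ℕ},
      TM2.stepAux (M l) v S = c → 1 ≤ n →
      ∃ m ≤ n, (flip bind (TM2.step M))^[m] (some ⟨some l, v, S⟩) = some c := by
    rintro l v S c n rfl hn
    exact ⟨1, hn, rfl⟩
  have trans : ∀ {a b c : Option (TM2.Cfg (fun _ : K => Bool) Λ σ)} {i j k : ℕ},
      (∃ m ≤ i, (flip bind (TM2.step M))^[m] a = b) →
      (∃ m ≤ j, (flip bind (TM2.step M))^[m] b = c) → i + j ≤ k →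
      ∃ m ≤ k, (flip bind (TM2.step M))^[m] a = c := by
    rintro a b c i j k ⟨m₁, h₁, rfl⟩ ⟨m₂, h₂, rfl⟩ hk
    exact ⟨m₂ + m₁, by omega, Function.iterate_add_apply _ _ _ _⟩
  induction h generalizing x with
  | push | peek | pop | load => exact one (by rw [hM]; rfl) le_rfl
  | seq _ _ ih₁ ih₂ =>
    exact trans (ih₁ (e ∘ Sum.inl) _ (fun l => hM (Sum.inl l)))
      (ih₂ (e ∘ Sum.inr) x (fun l => hM (Sum.inr l))) le_rfl
  | ite_true hc _ ih =>
    exact trans (one (by rw [hM]; simp only [entry, compile, TM2.stepAux, hc]; rfl) le_rfl)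
      (ih (e ∘ some ∘ Sum.inl) x (fun l => hM (some (Sum.inl l)))) (by omega)
  | ite_false hc _ ih =>
    exact trans (one (by rw [hM]; simp only [entry, compile, TM2.stepAux, hc]; rfl) le_rfl)
      (ih (e ∘ some ∘ Sum.inr) x (fun l => hM (some (Sum.inr l)))) (by omega)
  | loop_false hc =>
    exact one (by rw [hM]; simp only [entry, compile, TM2.stepAux, hc]; rfl) le_rfl
  | loop_true hc _ _ ih₁ ih₂ =>
    exact trans (trans
      (one (by rw [hM]; simp only [entry, compile, TM2.stepAux, hc]; rfl) le_rfl)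
      (ih₁ (e ∘ some) (e none) (fun l => hM (some l))) le_rfl)
      (ih₂ e x hM) (by omega)
  | mono _ h ih =>
    obtain ⟨m, hm, h'⟩ := ih e x hM
    exact ⟨m, hm.trans h, h'⟩

/-- The machine that runs a program on the input on stack `k` and then halts, with the output on
the same stack. -/
noncomputable def machine [Fintype K] [Fintype σ] (p : StackProg K σ) (k : K) (v : σ) : FinTM2 :=
  letI := p.finite_loc
  { K := K
    k₀ := k
    k₁ := k
    Γ := fun _ => Bool
    Λ := Option p.Loc
    main := some p.entry
    ΛFin := Fintype.ofFinite _
    σ := σ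
    initialState := v
    Γk₀Fin := inferInstanceAs (Fintype Bool)
    m := fun l => l.elim .halt (compile p some none) }

/-- The extra step executes the halting label. A halting configuration has the initial register and
all stacks but the output empty, so a program must clean up after itself. -/
theorem machine_outputs [Fintype K] [Fintype σ] {p : StackProg K σ} {k : K} {v : σ}
    {w w' : List Bool} {n : ℕ}
    (h : Run p v (update (fun _ => []) k w) v (update (fun _ => []) k w') n) :
    Nonempty (TM2OutputsInTime (p.machine k v) w (some w') (n + 1)) := by
  obtain ⟨m, hm, h⟩ := exists_iterate_of_run
    (fun l : Option p.Loc => l.elim .halt (compile p some none)) h some none (fun _ => rfl)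
  refine ⟨⟨⟨m + 1, ?_⟩, Nat.succ_le_succ hm⟩⟩
  have hi : initList (p.machine k v) w =
      (⟨some (some p.entry), v, update (fun _ => []) k w⟩ :
        TM2.Cfg (fun _ : K => Bool) (Option p.Loc) σ) := by
    refine congrArg (TM2.Cfg.mk (Γ := fun _ : K => Bool) _ _) (funext fun j => ?_)
    by_cases hj : j = k
    · exact (dif_pos hj).trans ((update_apply (fun _ : K => ([] : List Bool)) k w j).trans
        (if_pos hj)).symm
    · exact (dif_neg hj).trans ((update_apply (fun _ : K => ([] : List Bool)) k w j).trans
        (if_neg hj)).symm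
  have hf : haltList (p.machine k v) w' =
      (⟨none, v, update (fun _ => []) k w'⟩ :
        TM2.Cfg (fun _ : K => Bool) (Option p.Loc) σ) := by
    refine congrArg (TM2.Cfg.mk (Γ := fun _ : K => Bool) _ _) (funext fun j => ?_)
    by_cases hj : j = k
    · exact (dif_pos hj).trans ((update_apply (fun _ : K => ([] : List Bool)) k w' j).trans
        (if_pos hj)).symm
    · exact (dif_neg hj).trans ((update_apply (fun _ : K => ([] : List Bool)) k w' j).trans
        (if_neg hj)).symm
  rw [Function.iterate_succ_apply', hi]
  exact (congrArg (flip bind (p.machine k v).step) h).trans (congrArg some hf).symm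

end StackProg

/-! ### Stacks, register and elementary programs -/

/-- The contents of the machine that decides mult-primality. -/
inductive PrimalityStack : Type
  | io | src | cur | nxt | cur' | nxt' | out | dep
  deriving DecidableEq

instance : Fintype PrimalityStack where
  elems := {.io, .src, .cur, .nxt, .cur', .nxt', .out, .dep}
  complete := by intro k; cases k <;> decide

/-- The register of the machine that decides mult-primality: two bits read from contents, and
two flags. -/
structure PrimalityReg : Type where
  a : Option Bool
  b : Option Bool
  flag : Bool
  found : Bool
  deriving DecidableEq, Fintype

namespace PrimalityStack

open StackProg Function OrderedTree

/-- Stacks with the given contents. -/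
def contents (io src cur nxt cur' nxt' out dep : List Bool) : PrimalityStack → List Bool
  | .io => io
  | .src => src
  | .cur => cur
  | .nxt => nxt
  | .cur' => cur'
  | .nxt' => nxt'
  | .out => out
  | .dep => dep

section
variable (i s c n c' n' o d x : List Bool)

@[simp] theorem contents_io : contents i s c n c' n' o d io = i := rfl
@[simp] theorem contents_src : contents i s c n c' n' o d src = s := rfl
@[simp] theorem contents_cur : contents i s c n c' n' o d cur = c := rfl
@[simp] theorem contents_nxt : contents i s c n c' n' o d nxt = n := rfl
@[simp] theorem contents_cur' : contents i s c n c' n' o d PrimalityStack.cur' = c' := rfl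
@[simp] theorem contents_nxt' : contents i s c n c' n' o d PrimalityStack.nxt' = n' := rfl
@[simp] theorem contents_out : contents i s c n c' n' o d out = o := rfl
@[simp] theorem contents_dep : contents i s c n c' n' o d dep = d := rfl

@[simp] theorem update_io :
    update (contents i s c n c' n' o d) io x = contents x s c n c' n' o d := by
  funext k; cases k <;> rfl
@[simp] theorem update_src :
    update (contents i s c n c' n' o d) src x = contents i x c n c' n' o d := by
  funext k; cases k <;> rfl
@[simp] theorem update_cur :
    update (contents i s c n c' n' o d) cur x = contents i s x n c' n' o d := by
  funext k; cases k <;> rfl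
@[simp] theorem update_nxt :
    update (contents i s c n c' n' o d) nxt x = contents i s c x c' n' o d := by
  funext k; cases k <;> rfl
@[simp] theorem update_cur' :
    update (contents i s c n c' n' o d) PrimalityStack.cur' x = contents i s c n x n' o d := by
  funext k; cases k <;> rfl
@[simp] theorem update_nxt' :
    update (contents i s c n c' n' o d) PrimalityStack.nxt' x = contents i s c n c' x o d := by
  funext k; cases k <;> rfl
@[simp] theorem update_out :
    update (contents i s c n c' n' o d) out x = contents i s c n c' n' x d := by
  funext k; cases k <;> rfl
@[simp] theorem update_dep :
    update (contents i s c n c' n' o d) dep x = contents i s c n c' n' o x := by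
  funext k; cases k <;> rfl

end

theorem update_empty (w : List Bool) :
    update (fun _ => []) io w = contents w [] [] [] [] [] [] [] := by
  funext k; cases k <;> rfl

/-- Programs of the machine that decides mult-primality. -/
abbrev Prog := StackProg PrimalityStack PrimalityReg

theorem run_congr {p : Prog} {v v₁ v₂ : PrimalityReg} {S S₁ S₂ : PrimalityStack → List Bool}
    {m n : ℕ} (h : Run p v S v₁ S₁ m) (hv : v₁ = v₂) (hS : S₁ = S₂) (hn : m ≤ n) :
    Run p v S v₂ S₂ n := by
  subst hv hS
  exact h.mono hn

/-- Reads the top of a stack into the first bit of the register. -/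
def look (k : PrimalityStack) : Prog := .peek k (fun v x => { v with a := x })

/-- Pops a stack into the first bit of the register. -/
def take (k : PrimalityStack) : Prog := .pop k (fun v x => { v with a := x })

/-- Pops a stack into the second bit of the register. -/
def takeSnd (k : PrimalityStack) : Prog := .pop k (fun v x => { v with b := x })

/-- Pushes the first bit of the register. -/
def put (k : PrimalityStack) : Prog := .push k (fun v => v.a.getD false)

/-- Pushes the second bit of the register, if there is one. -/
def putSnd (k : PrimalityStack) : Prog :=
  .ite (fun v => v.b.isSome) (.push k (fun v => v.b.getD false)) (.load id)

/-- Pushes the first bit of the register, if there is one. -/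
def putIfSome (k : PrimalityStack) : Prog :=
  .ite (fun v => v.a.isSome) (put k) (.load id)

theorem run_look (k : PrimalityStack) (v : PrimalityReg) (S : PrimalityStack → List Bool) :
    Run (look k) v S { v with a := (S k).head? } S 1 := .peek ..

theorem run_take (k : PrimalityStack) (v : PrimalityReg) (S : PrimalityStack → List Bool) :
    Run (take k) v S { v with a := (S k).head? } (update S k (S k).tail) 1 := .pop ..

theorem run_takeSnd (k : PrimalityStack) (v : PrimalityReg) (S : PrimalityStack → List Bool) :
    Run (takeSnd k) v S { v with b := (S k).head? } (update S k (S k).tail) 1 := .pop ..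

theorem run_put (k : PrimalityStack) (v : PrimalityReg) (S : PrimalityStack → List Bool) :
    Run (put k) v S v (update S k (v.a.getD false :: S k)) 1 := .push ..

theorem run_putSnd (k : PrimalityStack) (v : PrimalityReg) (S : PrimalityStack → List Bool) :
    Run (putSnd k) v S v (update S k (v.b.toList ++ S k)) 2 := by
  rcases v with ⟨a, _ | b, f, g⟩
  · exact run_congr (.ite_false rfl (.load ..)) rfl (by simp) (by simp)
  · exact run_congr (.ite_true rfl (.push ..)) rfl (by simp) (by simp)

theorem run_putIfSome (k : PrimalityStack) (v : PrimalityReg) (S : PrimalityStack → List Bool) :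
    Run (putIfSome k) v S v (update S k (v.a.toList ++ S k)) 2 := by
  rcases v with ⟨_ | a, b, f, g⟩
  · exact run_congr (.ite_false rfl (.load ..)) rfl (by simp) (by simp)
  · exact run_congr (.ite_true rfl (.push ..)) rfl (by simp) (by simp)

/-- Moves the contents of the stack `X` to the stack `Y`, in reverse order. -/
def moveAll (X Y : PrimalityStack) : Prog :=
  .seq (look X) <| .loop (fun v => v.a.isSome) <| .seq (take X) <| .seq (put Y) <| look X

theorem run_moveAll {X Y : PrimalityStack} (h : X ≠ Y) (v : PrimalityReg)
    (S : PrimalityStack → List Bool) :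
    Run (moveAll X Y) v S { v with a := none }
      (update (update S X []) Y ((S X).reverse ++ S Y)) (4 * (S X).length + 2) := by
  suffices H : ∀ (x : List Bool) (v : PrimalityReg) (S : PrimalityStack → List Bool), S X = x →
      Run (.loop (fun v => v.a.isSome) <| .seq (take X) <| .seq (put Y) <| look X)
        { v with a := x.head? } S { v with a := none }
        (update (update S X []) Y (x.reverse ++ S Y)) (4 * x.length + 1) by
    exact run_congr (.seq (run_look X v S) (H _ v S rfl)) rfl rfl (by omega)
  intro x
  induction x with
  | nil =>
    intro v S hS
    refine run_congr (.loop_false rfl) rfl ?_ (by simp)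
    have : update S X [] = S := by rw [← hS, update_eq_self]
    simp [this]
  | cons b x ih =>
    intro v S hS
    have h₁ := run_take X { v with a := some b } S
    have h₂ := run_put Y { v with a := some b } (update S X x)
    have h₃ := run_look X { v with a := some b } (update (update S X x) Y (b :: S Y))
    have h₄ := ih v (update (update S X x) Y (b :: S Y)) (by simp [h])
    simp only [hS, List.head?_cons, List.tail_cons] at h₁
    simp only [Option.getD_some, update_of_ne h.symm] at h₂
    simp only [update_of_ne h, update_self] at h₃
    refine run_congr (.loop_true rfl (.seq h₁ (.seq h₂ h₃)) h₄) rfl ?_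
      (by simp only [List.length_cons]; omega)
    funext k
    by_cases hY : k = Y
    · subst hY; simp
    · by_cases hX : k = X
      · subst hX; simp [hY]
      · simp [hX, hY]

/-- Empties a stack. -/
def clear (X : PrimalityStack) : Prog :=
  .seq (look X) <| .loop (fun v => v.a.isSome) <| .seq (take X) <| look X

theorem run_clear (X : PrimalityStack) (v : PrimalityReg) (S : PrimalityStack → List Bool) :
    Run (clear X) v S { v with a := none } (update S X []) (3 * (S X).length + 2) := by
  suffices H : ∀ (x : List Bool) (v : PrimalityReg) (S : PrimalityStack → List Bool), S X = x →
      Run (.loop (fun v => v.a.isSome) <| .seq (take X) <| look X) { v with a := x.head? } S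
        { v with a := none } (update S X []) (3 * x.length + 1) by
    exact run_congr (.seq (run_look X v S) (H _ v S rfl)) rfl rfl (by omega)
  intro x
  induction x with
  | nil =>
    intro v S hS
    refine run_congr (.loop_false rfl) rfl ?_ (by simp)
    rw [← hS]; simp
  | cons c x ih =>
    intro v S hS
    have h₁ := run_take X { v with a := some c } S
    have h₂ := run_look X { v with a := some c } (update S X x)
    have h₃ := ih v (update S X x) (by simp)
    simp only [hS, List.head?_cons, List.tail_cons] at h₁
    simp only [update_self] at h₂
    exact run_congr (.loop_true rfl (.seq h₁ h₂) h₃) rfl (by simp)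
      (by simp only [List.length_cons]; omega)

/-- Moves the top of the stack `X` to the stack `Y`, and keeps on the stack `dep` one bit for each
tree that has been entered and not yet left. -/
def moveTreeStep (X Y : PrimalityStack) : Prog :=
  .seq (take X) <| .seq (put Y) <| .seq
    (.ite (fun v => v.a = some true) (.push dep fun _ => true) (.pop dep fun v _ => v)) (look dep)

/-- Moves the code of a tree from the stack `X` to the stack `Y`, in reverse order. -/
def moveTree (X Y : PrimalityStack) : Prog :=
  .seq (.load fun v => { v with a := some true }) <|
    .loop (fun v => v.a.isSome) (moveTreeStep X Y)

/-- The contents `S` with new contents of the three contents that `moveTree X Y` uses. -/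
def moveTreeStacks (S : PrimalityStack → List Bool) (X Y : PrimalityStack) (x y d : List Bool) :
    PrimalityStack → List Bool :=
  update (update (update S X x) Y y) dep d

theorem run_moveTreeStep {X Y : PrimalityStack} (h : X ≠ Y) (hX : X ≠ dep) (hY : Y ≠ dep)
    (v : PrimalityReg) (S : PrimalityStack → List Bool) (b : Bool) (x y d : List Bool) :
    Run (moveTreeStep X Y) v (moveTreeStacks S X Y (b :: x) y d)
      { v with a := (bif b then true :: d else d.tail).head? }
      (moveTreeStacks S X Y x (b :: y) (bif b then true :: d else d.tail)) 5 := by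
  have h₁ := run_take X v (moveTreeStacks S X Y (b :: x) y d)
  have h₂ := run_put Y { v with a := some b }
    (update (moveTreeStacks S X Y (b :: x) y d) X x)
  have e₁ : moveTreeStacks S X Y (b :: x) y d X = b :: x := by
    simp [moveTreeStacks, h, hX]
  have e₂ : update (update (moveTreeStacks S X Y (b :: x) y d) X x) Y
      (b :: update (moveTreeStacks S X Y (b :: x) y d) X x Y) =
        moveTreeStacks S X Y x (b :: y) d := by
    funext k
    simp only [moveTreeStacks, update_apply]
    split_ifs <;> simp_all
  have e₃ : moveTreeStacks S X Y x (b :: y) d dep = d := by simp [moveTreeStacks]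
  have e₄ : ∀ d', update (moveTreeStacks S X Y x (b :: y) d) dep d' =
      moveTreeStacks S X Y x (b :: y) d' := by simp [moveTreeStacks]
  have e₅ : ∀ d', moveTreeStacks S X Y x (b :: y) d' dep = d' := by simp [moveTreeStacks]
  rw [e₁] at h₁
  simp only [Option.getD_some, e₂] at h₂
  refine run_congr (.seq h₁ (.seq h₂ (.seq (m := 2)
    (v₁ := { v with a := some b })
    (S₁ := moveTreeStacks S X Y x (b :: y) (bif b then true :: d else d.tail)) ?_
    (run_look dep _ _)))) (by simp [e₅]) rfl le_rfl
  cases b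
  · exact run_congr (.ite_false rfl (.pop ..)) rfl (by simp [e₃, e₄]) le_rfl
  · exact run_congr (.ite_true rfl (.push ..)) rfl (by simp [e₃, e₄]) le_rfl

/-- Stated by continuation: a `Run` of a loop always covers the loop to its end, so the effect of
some rounds is expressed by prefixing them to a run of the remaining ones. The nonempty depth stack
keeps the loop going throughout the forest. -/
theorem run_moveTree_loop {X Y : PrimalityStack} (h : X ≠ Y) (hX : X ≠ dep) (hY : Y ≠ dep)
    (v : PrimalityReg) (S : PrimalityStack → List Bool) (l : List OrderedTree)
    {v' : PrimalityReg} {S' : PrimalityStack → List Bool} {m : ℕ} (x y d : List Bool)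
    (H : Run (.loop (fun v => v.a.isSome) (moveTreeStep X Y)) { v with a := some true }
      (moveTreeStacks S X Y x ((codes l).reverse ++ y) (true :: d)) v' S' m) :
    Run (.loop (fun v => v.a.isSome) (moveTreeStep X Y)) { v with a := some true }
      (moveTreeStacks S X Y (codes l ++ x) y (true :: d)) v' S' (m + 6 * (codes l).length) := by
  suffices ∀ n, ∀ l : List OrderedTree, (codes l).length ≤ n → ∀ (m : ℕ) (x y d : List Bool),
      Run (.loop (fun v => v.a.isSome) (moveTreeStep X Y)) { v with a := some true }
        (moveTreeStacks S X Y x ((codes l).reverse ++ y) (true :: d)) v' S' m →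
      Run (.loop (fun v => v.a.isSome) (moveTreeStep X Y)) { v with a := some true }
        (moveTreeStacks S X Y (codes l ++ x) y (true :: d)) v' S' (m + 6 * (codes l).length) from
    this _ l le_rfl m x y d H
  intro n
  induction n with
  | zero =>
    rintro (_ | ⟨⟨s⟩, r⟩) hn m x y d H
    · exact run_congr H rfl rfl (by simp)
    · simp [code_node] at hn
  | succ n ih =>
    rintro (_ | ⟨⟨s⟩, r⟩) hn m x y d H
    · exact run_congr H rfl rfl (by simp)
    · simp only [codes_cons, code_node, List.cons_append, List.length_cons,
        List.append_assoc, List.length_append, List.reverse_cons, List.reverse_append,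
        List.nil_append] at hn H ⊢
      have h₃ := ih r (by omega) m x _ d H
      have h₂ := run_moveTreeStep h hX hY { v with a := some true } S false (codes r ++ x)
        ((codes s).reverse ++ true :: y) (true :: true :: d)
      have h₁ := ih s (by omega) _ _ _ (true :: d) (.loop_true rfl h₂ h₃)
      have h₀ := run_moveTreeStep h hX hY { v with a := some true } S true
        (codes s ++ false :: (codes r ++ x)) y (true :: d)
      exact run_congr (.loop_true rfl h₀ h₁) rfl rfl (by omega)

theorem run_moveTree {X Y : PrimalityStack} (h : X ≠ Y) (hX : X ≠ dep) (hY : Y ≠ dep)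
    (v : PrimalityReg) (S : PrimalityStack → List Bool) (t : OrderedTree) (x y : List Bool) :
    Run (moveTree X Y) v (moveTreeStacks S X Y (t.code ++ x) y []) { v with a := none }
      (moveTreeStacks S X Y x (t.code.reverse ++ y) []) (6 * t.code.length + 2) := by
  rcases t with ⟨l⟩
  simp only [code_node, List.cons_append, List.length_cons, List.append_assoc, List.length_append,
    List.reverse_cons, List.reverse_append, List.nil_append, List.length_nil, List.reverse_nil]
  have h₀ := run_moveTreeStep h hX hY { v with a := some true } S true
    (codes l ++ false :: x) y []
  have h₂ := run_moveTreeStep h hX hY { v with a := some true } S false x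
    ((codes l).reverse ++ true :: y) [true]
  -- The closing `0` of the root empties the depth stack, which ends the loop exactly at the end of
  -- the tree.
  have h₁ := run_moveTree_loop h hX hY v S l (false :: x) (true :: y) []
    (.loop_true rfl h₂ (.loop_false rfl))
  exact run_congr (.seq (.load ..) (.loop_true rfl h₀ h₁)) rfl rfl (by omega)

theorem run_moveTree_cur (v : PrimalityReg) (t : OrderedTree)
    (i s c n c' n' o : List Bool) :
    Run (moveTree io cur) v (contents (t.code ++ i) s c n c' n' o []) { v with a := none }
      (contents i s (t.code.reverse ++ c) n c' n' o []) (6 * t.code.length + 2) := by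
  simpa [moveTreeStacks] using run_moveTree (X := io) (Y := cur) (by decide) (by decide)
    (by decide) v (contents i s c n c' n' o []) t i c

theorem run_moveTree_nxt (v : PrimalityReg) (t : OrderedTree)
    (i s c n c' n' o : List Bool) :
    Run (moveTree io nxt) v (contents (t.code ++ i) s c n c' n' o []) { v with a := none }
      (contents i s c (t.code.reverse ++ n) c' n' o []) (6 * t.code.length + 2) := by
  simpa [moveTreeStacks] using run_moveTree (X := io) (Y := nxt) (by decide) (by decide)
    (by decide) v (contents i s c n c' n' o []) t i n

end PrimalityStack

/-! ### Comparison of keys -/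

namespace PrimalityStack

open StackProg Function OrderedTree

/-- The bijective base-two digit of a bit, and `0` beyond the end of a list. -/
def digit : Option Bool → ℕ
  | none => 0
  | some b => 1 + b.toNat

/-- One step of `compare`. -/
def compareStep : Prog :=
  .seq (take cur) <| .seq (takeSnd nxt) <| .seq (putIfSome cur') <| .seq (putSnd nxt') <|
    .load fun v => { v with flag := if v.a = v.b then v.flag else decide (digit v.a < digit v.b) }

/-- The loop of `compare`. -/
def compareLoop : Prog := .loop (fun v => v.a.isSome || v.b.isSome) compareStep

/-- Compares the numbers whose digits are on `cur` and `nxt`, and moves these two stacks to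
`cur'` and `nxt'`, in reverse order; sets the flag if the first number is smaller. -/
def compare : Prog :=
  .seq (.load fun v => { v with a := some true, flag := false }) compareLoop

theorem run_compareStep (v : PrimalityReg) (i s x y x' y' o d : List Bool) :
    Run compareStep v (contents i s x y x' y' o d)
      ⟨x.head?, y.head?, if x.head? = y.head? then v.flag else
        decide (digit x.head? < digit y.head?), v.found⟩
      (contents i s x.tail y.tail (x.head?.toList ++ x') (y.head?.toList ++ y') o d) 7 :=
  run_congr (.seq (run_take ..) (.seq (run_takeSnd ..) (.seq (run_putIfSome ..)
    (.seq (run_putSnd ..) (.load ..))))) (by simp) (by simp) le_rfl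

theorem bijNum_eq_digit_add (l : List Bool) : bijNum l = digit l.head? + 2 * bijNum l.tail := by
  cases l <;> simp [bijNum, digit]

theorem digit_injective : Function.Injective digit := by
  intro x y; revert x y; decide

theorem digit_le (x : Option Bool) : digit x ≤ 2 := by
  revert x; decide

/-- Digits arrive least significant first, so a later difference overrides an earlier one. Digits
`1` and `2`, with `0` only beyond the end of a word, keep this correct for words of different
lengths: if `a < b` then `d + 2 * a ≤ 2 * b < d' + 2 * b`, because `d ≤ 2` and `d' ≥ 1`. -/
theorem compare_flag (x y : List Bool) (f : Bool) :
    (if bijNum x.tail = bijNum y.tail then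
        (if x.head? = y.head? then f else decide (digit x.head? < digit y.head?))
      else decide (bijNum x.tail < bijNum y.tail)) =
      if bijNum x = bijNum y then f else decide (bijNum x < bijNum y) := by
  have H : ∀ d d' a b m n : ℕ, m = d + 2 * a → n = d' + 2 * b → d ≤ 2 → d' ≤ 2 →
      (d = 0 → a = 0) → (d' = 0 → b = 0) →
      (if a = b then (if d = d' then f else decide (d < d')) else decide (a < b)) =
        if m = n then f else decide (m < n) := by
    intro d d' a b m n hm hn hd hd' ha hb
    split_ifs <;> first | rfl | (exfalso; omega) | (simp only [decide_eq_decide]; omega)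
  have hd : ∀ l : List Bool, digit l.head? = 0 → bijNum l.tail = 0 := by
    rintro (_ | ⟨_, _⟩) <;> simp [digit, bijNum]
  have hh : x.head? = y.head? ↔ digit x.head? = digit y.head? :=
    ⟨fun h => by rw [h], fun h => digit_injective h⟩
  simp only [hh]
  exact H _ _ _ _ _ _ (bijNum_eq_digit_add x) (bijNum_eq_digit_add y) (digit_le _) (digit_le _)
    (hd x) (hd y)

theorem run_compareLoop (k : ℕ) :
    ∀ (v : PrimalityReg) (i s x y x' y' o d : List Bool), x.length + y.length ≤ k →
      (v.a.isSome || v.b.isSome) = true →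
      Run compareLoop v (contents i s x y x' y' o d)
        ⟨none, none, if bijNum x = bijNum y then v.flag else decide (bijNum x < bijNum y),
          v.found⟩
        (contents i s [] [] (x.reverse ++ x') (y.reverse ++ y') o d) (8 * k + 9) := by
  induction k with
  | zero =>
    intro v i s x y x' y' o d h hv
    obtain rfl : x = [] := List.length_eq_zero_iff.1 (by omega)
    obtain rfl : y = [] := List.length_eq_zero_iff.1 (by omega)
    exact run_congr (.loop_true hv (run_compareStep ..) (.loop_false rfl)) (by simp) (by simp)
      (by omega)
  | succ k ih =>
    intro v i s x y x' y' o d h hv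
    have h₁ := run_compareStep v i s x y x' y' o d
    by_cases h₀ : x = [] ∧ y = []
    · obtain ⟨rfl, rfl⟩ := h₀
      exact run_congr (.loop_true hv h₁ (.loop_false rfl)) (by simp) (by simp)
        (by omega)
    · refine run_congr (.loop_true hv h₁ (ih _ _ _ _ _ _ _ _ _ ?_ ?_)) ?_ ?_ (by omega)
      · cases x <;> cases y <;> simp at h h₀ ⊢ <;> omega
      · cases x <;> cases y <;> simp at h₀ ⊢
      · rw [compare_flag]
      · cases x <;> cases y <;> simp

theorem run_compare (v : PrimalityReg) (i s : List Bool) (t u : OrderedTree) :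
    Run compare v (contents i s t.code.reverse u.code.reverse [] [] o [])
      ⟨none, none, decide (t.key < u.key), v.found⟩
      (contents i s [] [] t.code u.code o []) (8 * (t.code.length + u.code.length) + 10) := by
  refine run_congr (.seq (.load ..) (run_compareLoop _ _ _ _ _ _ _ _ _ _ le_rfl rfl)) ?_
    (by simp) (by simp only [List.length_reverse]; omega)
  change (⟨none, none, if t.key = u.key then false else decide (t.key < u.key), v.found⟩ :
    PrimalityReg) = _
  congr 1
  split_ifs with h
  · simp [h]
  · rfl

/-! ### Canonicalization by insertion -/

/-- Carries the tree on `cur` past one more sibling, as in bubble sort. -/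
def bubbleStep : Prog :=
  .seq (moveTree io nxt) <| .seq compare <| .seq
    (.ite (fun v => v.flag)
      (.seq (moveAll nxt' cur) (moveAll cur' out))
      (.seq (moveAll cur' cur) (moveAll nxt' out)))
    (look io)

/-- Carries the tree on `cur` past all its siblings, as in bubble sort. -/
def bubbleLoop : Prog := .loop (fun v => v.a = some true) bubbleStep

/-- Inserts the first tree on `io` into the sorted list of its siblings. -/
def insert : Prog :=
  .seq (.load fun v => { v with b := none }) <| .seq (moveTree io cur) <| .seq (look io) <| .seq bubbleLoop <| .seq (moveAll cur io) <|
    .seq (moveAll out io) (.load fun _ => ⟨none, none, false, false⟩)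

theorem run_bubbleStep (v : PrimalityReg) (i s o : List Bool) (t u : OrderedTree) :
    Run bubbleStep v (contents (u.code ++ i) s t.code.reverse [] [] [] o [])
      ⟨i.head?, none, decide (t.key < u.key), v.found⟩
      (contents i s (if t.key < u.key then u else t).code.reverse [] [] []
        ((if t.key < u.key then t else u).code.reverse ++ o) [])
      (18 * (t.code.length + u.code.length) + 20) := by
  have h₁ := run_moveTree_nxt v u i s t.code.reverse [] [] [] o
  rw [List.append_nil] at h₁
  have h₂ := run_compare (o := o) { v with a := none } i s t u
  by_cases h : t.key < u.key
  · refine run_congr (.seq h₁ (.seq h₂ (.seq (.ite_true (by simp [h])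
      (.seq (run_moveAll (by decide) _ _) (run_moveAll (by decide) _ _))) (run_look ..))))
      ?_ ?_ ?_
    · simp
    · simp [h]
    · simp; omega
  · refine run_congr (.seq h₁ (.seq h₂ (.seq (.ite_false (by simp [h])
      (.seq (run_moveAll (by decide) _ _) (run_moveAll (by decide) _ _))) (run_look ..))))
      ?_ ?_ ?_
    · simp
    · simp [h]
    · simp; omega

/-- The condition on `z` makes the loop stop exactly after the last sibling, where no `1` follows.
The tree still carried at the end is hidden in `c`; only its place after the emitted trees matters.
-/
theorem run_bubbleLoop (N : ℕ) (z s : List Bool) (hz : z.head? ≠ some true) (g : Bool)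
    (l : List OrderedTree) :
    ∀ (t : OrderedTree) (f : Bool) (o : List Bool), (codes (t :: l)).length ≤ N →
      ∃ (f' : Bool) (c o' : List Bool),
        o'.reverse ++ c.reverse = o.reverse ++ codes (bubble t l) ∧
        Run bubbleLoop ⟨(codes l ++ z).head?, none, f, g⟩
          (contents (codes l ++ z) s t.code.reverse [] [] [] o [])
          ⟨z.head?, none, f', g⟩ (contents z s c [] [] [] o' [])
          (l.length * (18 * N + 21) + 1) := by
  induction l with
  | nil =>
    intro t f o h
    exact ⟨f, t.code.reverse, o, by simp [bubble], .mono (.loop_false (decide_eq_false hz))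
      (by omega)⟩
  | cons u l ih =>
    intro t f o h
    simp only [codes_cons, List.length_append] at h
    obtain ⟨f', c, o', h', hr⟩ := ih (if t.key < u.key then u else t) (decide (t.key < u.key))
      ((if t.key < u.key then t else u).code.reverse ++ o)
      (by split_ifs <;> simp <;> omega)
    refine ⟨f', c, o', ?_, ?_⟩
    · rw [h']
      simp only [bubble]
      split_ifs <;> simp
    · have h₁ := run_bubbleStep ⟨some true, none, f, g⟩ (codes l ++ z) s o t u
      refine run_congr (v₁ := ⟨z.head?, none, f', g⟩) (S₁ := contents z s c [] [] [] o' [])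
        (m := (18 * (t.code.length + u.code.length) + 20) + 1 +
          (l.length * (18 * N + 21) + 1)) ?_ rfl rfl ?_
      · rw [codes_cons, List.append_assoc]
        have : (u.code ++ (codes l ++ z)).head? = some true := by
          cases u; simp [code_node]
        rw [this]
        exact .loop_true (by simp) h₁ hr
      · simp only [List.length_cons, Nat.add_mul]
        omega

theorem length_codes_bubble (t : OrderedTree) (l : List OrderedTree) :
    (codes (bubble t l)).length = (codes (t :: l)).length :=
  length_codes_of_perm (bubble_perm t l)

theorem run_insert (N : ℕ) (v : PrimalityReg) (z s : List Bool) (hz : z.head? ≠ some true)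
    (t : OrderedTree) (l : List OrderedTree) (hN : (codes (t :: l)).length ≤ N) :
    Run insert v (contents (codes (t :: l) ++ z) s [] [] [] [] [] [])
      ⟨none, none, false, false⟩ (contents (codes (bubble t l) ++ z) s [] [] [] [] [] [])
      (N * (18 * N + 21) + 10 * N + 10) := by
  have h₁ := run_moveTree_cur ⟨v.a, none, v.flag, v.found⟩ t (codes l ++ z) s [] [] [] [] []
  rw [List.append_nil] at h₁
  obtain ⟨f', c, o', h, hr⟩ := run_bubbleLoop N z s hz v.found l t v.flag [] hN
  have hlen := congrArg List.length h
  simp only [List.reverse_nil, List.nil_append, length_codes_bubble, List.length_append,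
    List.length_reverse] at hlen
  have hl : l.length * (18 * N + 21) ≤ N * (18 * N + 21) := by
    refine Nat.mul_le_mul_right _ ((length_le_length_codes l).trans (le_trans ?_ hN))
    simp
  rw [codes_cons, List.append_assoc]
  refine run_congr (.seq (.load ..) (.seq h₁ (.seq (run_look io ⟨none, none, v.flag, v.found⟩
    (contents (codes l ++ z) s t.code.reverse [] [] [] [] []))
    (.seq hr (.seq (run_moveAll (by decide) ..) (.seq (run_moveAll (by decide) ..) (.load ..)))))))
    rfl ?_ ?_
  · simp only [contents_cur, contents_io, contents_out, update_cur, update_io, update_out]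
    rw [← List.append_assoc, h]
    simp
  · simp only [contents_cur, contents_io, contents_out, update_cur, update_io]
    simp only [codes_cons, List.length_append] at hlen hN
    omega

/-- Moves one bit from `src` to `io`, and inserts the tree that it completes, if any. -/
def canonicalizeStep : Prog :=
  .seq (take src) <| .seq (put io) <| .seq
    (.ite (fun v => v.a = some true) insert (.load fun _ => ⟨none, none, false, false⟩)) (look src)

/-- The loop of `canonicalize`. -/
def canonicalizeLoop : Prog := .loop (fun v => v.a.isSome) canonicalizeStep

/-- Sorts the subtrees of each vertex of the tree on `io`. -/
def canonicalize : Prog := .seq (moveAll io src) <| .seq (look src) canonicalizeLoop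

theorem run_canonicalizeStep_false (v : PrimalityReg) (i x : List Bool) :
    Run canonicalizeStep v (contents i (false :: x) [] [] [] [] [] [])
      ⟨x.head?, none, false, false⟩ (contents (false :: i) x [] [] [] [] [] []) 5 :=
  run_congr (.seq (run_take ..) (.seq (run_put ..) (.seq (.ite_false rfl (.load ..))
    (run_look ..)))) (by simp) (by simp) le_rfl

theorem run_canonicalizeStep_true (N : ℕ) (v : PrimalityReg) (z x : List Bool)
    (hz : z.head? ≠ some true) (s l : List OrderedTree) (hN : (codes (node s :: l)).length ≤ N) :
    Run canonicalizeStep v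
      (contents (codes s ++ false :: (codes l ++ z)) (true :: x) [] [] [] [] [] [])
      ⟨x.head?, none, false, false⟩
      (contents (codes (bubble (node s) l) ++ z) x [] [] [] [] [] [])
      (N * (18 * N + 21) + 10 * N + 14) := by
  have h := run_insert N { v with a := some true } z x hz (node s) l hN
  rw [codes_cons, code_node] at h
  simp only [List.cons_append, List.append_assoc, List.nil_append] at h
  refine run_congr (.seq (run_take ..) (.seq (run_put ..) (.seq (.ite_true
    (m := N * (18 * N + 21) + 10 * N + 10) rfl ?_)
    (run_look src ⟨none, none, false, false⟩ (contents (codes (bubble (node s) l) ++ z) x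
      [] [] [] [] [] []))))) (by simp) (by simp) ?_
  · simpa using h
  · omega

theorem length_code_canon (t : OrderedTree) : (canon t).code.length = t.code.length := by
  rw [length_code, length_code, numVertices_canon]

theorem length_codes_foldr_bubble (l r : List OrderedTree) :
    (codes ((l.map canon).foldr bubble r)).length = (codes l).length + (codes r).length := by
  induction l with
  | nil => simp
  | cons t l ih =>
    simp [length_codes_bubble, ih, length_code_canon]; omega

/-- The code is read from its end, so descendants and right siblings are sorted before a tree is
completed by its opening `1` and inserted. Here `r` holds the already sorted right siblings, `K`
bounds the cost per bit, and the rest of the loop enters as a continuation. -/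
theorem run_canonicalizeLoop (N K : ℕ) (hK : N * (18 * N + 21) + 10 * N + 15 ≤ K)
    {v' : PrimalityReg} {S' : PrimalityStack → List Bool} (k : ℕ) :
    ∀ (l r : List OrderedTree) (z x : List Bool) (m : ℕ), (codes l).length ≤ k →
      z.head? ≠ some true → (codes l).length + (codes r).length ≤ N →
      Run canonicalizeLoop ⟨x.head?, none, false, false⟩
        (contents (codes ((l.map canon).foldr bubble r) ++ z) x [] [] [] [] [] []) v' S' m →
      Run canonicalizeLoop ⟨((codes l).reverse ++ x).head?, none, false, false⟩
        (contents (codes r ++ z) ((codes l).reverse ++ x) [] [] [] [] [] []) v' S'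
        (m + (codes l).length * K) := by
  induction k with
  | zero =>
    rintro (_ | ⟨⟨s⟩, l⟩) r z x m hk hz hN H
    · exact run_congr H rfl rfl (by simp)
    · simp [code_node] at hk
  | succ k ih =>
    rintro (_ | ⟨⟨s⟩, l⟩) r z x m hk hz hN H
    · exact run_congr H rfl rfl (by simp)
    · simp only [codes_cons, code_node, List.cons_append, List.length_cons,
        List.append_assoc, List.length_append, List.reverse_cons, List.reverse_append,
        List.nil_append, List.map_cons, List.foldr_cons, canon_node] at hk hN H ⊢
      have h₃ := run_canonicalizeStep_true N ⟨some true, none, false, false⟩ z x hz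
        (bubbleSort (s.map canon)) ((l.map canon).foldr bubble r) (by
          have := length_code_canon (node s)
          rw [canon_node] at this
          rw [codes_cons, List.length_append, this, length_codes_foldr_bubble]
          simp only [code_node, List.length_cons, List.length_append, List.length_nil]
          omega)
      -- The children form a new forest with no sorted siblings yet; the closing `0` of their parent
      -- separates them from the rest of the stack.
      have h₂ := ih s [] (false :: (codes ((l.map canon).foldr bubble r) ++ z)) (true :: x) _
        (by omega) (by simp) (by simp; omega) (.loop_true rfl h₃ H)
      have h₁ := run_canonicalizeStep_false ⟨some false, none, false, false⟩
        (codes ((l.map canon).foldr bubble r) ++ z) ((codes s).reverse ++ true :: x)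
      have h₀ := ih l r z (false :: ((codes s).reverse ++ true :: x)) _ (by omega) hz (by omega) (.loop_true rfl h₁ h₂)
      refine run_congr h₀ rfl rfl ?_
      simp only [Nat.add_mul]
      omega

theorem run_canonicalize (v : PrimalityReg) (hv : v = ⟨none, none, false, false⟩)
    (t : OrderedTree) (N : ℕ) (hN : t.code.length = N) :
    Run canonicalize v (contents t.code [] [] [] [] [] [] []) ⟨none, none, false, false⟩
      (contents (canon t).code [] [] [] [] [] [] [])
      (N * (N * (18 * N + 21) + 10 * N + 19) + 4) := by
  subst hv
  have h := run_canonicalizeLoop N _ le_rfl (codes [t]).length [t] [] [] [] 1 le_rfl (by simp)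
    (by simp [hN]) (.loop_false rfl)
  simp only [codes_cons, codes_nil, List.append_nil, List.map_cons, List.map_nil,
    List.foldr_cons, List.foldr_nil, bubble, hN] at h
  have h₁ := run_moveAll (X := io) (Y := src) (by decide) ⟨none, none, false, false⟩
    (contents t.code [] [] [] [] [] [] [])
  simp only [contents_io, contents_src, update_io, update_src, List.append_nil, hN] at h₁
  refine run_congr (.seq h₁ (.seq
    (run_look src ⟨none, none, false, false⟩ (contents [] t.code.reverse [] [] [] [] [] []))
    h)) rfl rfl ?_
  simp only [Nat.mul_add]
  omega

end PrimalityStack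

/-! ### Recognizing the image of the substitution -/

namespace PrimalityStack

open StackProg Function OrderedTree

/-- Compares the next bit on `nxt` with the next bit on `io`. -/
def matchStep : Prog :=
  .seq (take nxt) <| .seq (put nxt') <| .seq (takeSnd io) <| .seq (putSnd cur') <|
    .seq (.load fun v => { v with b := none, flag := v.flag && v.a == v.b }) (look nxt)

/-- The loop of `matchWord`. -/
def matchLoop : Prog := .loop (fun v => v.a.isSome) matchStep

/-- Clears the flag unless the word on `nxt` is a prefix of the word on `io`, which loses as many
bits to `cur'`. -/
def matchWord : Prog := .seq (look nxt) <| .seq matchLoop (moveAll nxt' nxt)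

theorem run_matchStep (v : PrimalityReg) (i s c w c' n' o d : List Bool) (b : Bool) :
    Run matchStep v (contents i s c (b :: w) c' n' o d)
      ⟨w.head?, none, v.flag && some b == i.head?, v.found⟩
      (contents i.tail s c w (i.head?.toList ++ c') (b :: n') o d) 7 :=
  run_congr (.seq (run_take ..) (.seq (run_put ..) (.seq (run_takeSnd ..)
    (.seq (run_putSnd ..) (.seq (.load ..) (run_look ..)))))) (by simp) (by simp) le_rfl

theorem run_matchLoop (w : List Bool) :
    ∀ (f g : Bool) (i s c c' n' o d : List Bool),
      Run matchLoop ⟨w.head?, none, f, g⟩ (contents i s c w c' n' o d)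
        ⟨none, none, f && w.isPrefixOf i, g⟩
        (contents (i.drop w.length) s c [] ((i.take w.length).reverse ++ c')
          (w.reverse ++ n') o d) (8 * w.length + 1) := by
  induction w with
  | nil => exact fun f g i s c c' n' o d => run_congr (.loop_false rfl) (by simp) (by simp) (by simp)
  | cons b w ih =>
    intro f g i s c c' n' o d
    have h := run_matchStep ⟨some b, none, f, g⟩ i s c w c' n' o d b
    refine run_congr (.loop_true rfl h (ih _ _ _ _ _ _ _ _ _)) ?_ ?_
      (by simp only [List.length_cons]; omega)
    · cases i <;> simp [List.isPrefixOf, Bool.and_assoc]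
    · cases i <;> simp

theorem run_matchWord (v : PrimalityReg) (hv : v.b = none) (i s c w c' o d : List Bool) :
    Run matchWord v (contents i s c w c' [] o d)
      ⟨none, none, v.flag && w.isPrefixOf i, v.found⟩
      (contents (i.drop w.length) s c w ((i.take w.length).reverse ++ c') [] o d)
      (12 * w.length + 4) := by
  obtain ⟨a, b, f, g⟩ := v
  obtain rfl : b = none := hv
  refine run_congr (.seq (run_look nxt ⟨a, none, f, g⟩ (contents i s c w c' [] o d))
    (.seq (run_matchLoop w f g i s c c' [] o d) (run_moveAll (by decide) ..))) rfl ?_ ?_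
  · simp
  · simp; omega

/-- One step of `scan`. -/
def scanStep : Prog :=
  .seq (take io) <| .seq (put cur') <| .seq
    (.ite (fun v => v.a = some true) matchWord (.load id)) (look io)

/-- The loop of `scan`. -/
def scanLoop : Prog := .loop (fun v => v.a.isSome) scanStep

/-- Clears the flag unless the word on `io` is in the image of the substitution `expand w`, where
`w` is the word on `nxt`. -/
def scan : Prog := .seq (look io) <| .seq scanLoop (moveAll cur' io)

theorem run_scanStep_false (g f : Bool) (i s c w c' o d : List Bool) :
    Run scanStep ⟨some false, none, f, g⟩ (contents (false :: i) s c w c' [] o d)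
      ⟨i.head?, none, f, g⟩ (contents i s c w (false :: c') [] o d) 5 :=
  run_congr (.seq (run_take ..) (.seq (run_put ..) (.seq (.ite_false rfl (.load ..))
    (run_look ..)))) (by simp) (by simp) le_rfl

theorem run_scanStep_true (g f : Bool) (i s c w c' o d : List Bool) :
    Run scanStep ⟨some true, none, f, g⟩ (contents (true :: i) s c w c' [] o d)
      ⟨(i.drop w.length).head?, none, f && w.isPrefixOf i, g⟩
      (contents (i.drop w.length) s c w ((i.take w.length).reverse ++ true :: c') [] o d)
      (12 * w.length + 8) := by
  have h := run_matchWord ⟨some true, none, f, g⟩ rfl i s c w (true :: c') o d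
  refine run_congr (.seq (run_take ..) (.seq (run_put ..) (.seq (.ite_true
    (m := 12 * w.length + 4) rfl ?_) (run_look io ⟨none, none, f && w.isPrefixOf i, g⟩
      (contents (i.drop w.length) s c w ((i.take w.length).reverse ++ true :: c') [] o d)))))
    rfl rfl (by omega)
  simpa using h

/-- Preimages are forced bit by bit: a leading `1` can only come from a `1`, which also produces
`w`. Hence a scan without backtracking suffices. -/
theorem isPrefixOf_and_exists_expand (w i : List Bool) :
    (w.isPrefixOf i = true ∧ ∃ u, i.drop w.length = expand w u) ↔
      ∃ u, true :: i = expand w u := by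
  constructor
  · rintro ⟨h, u, hu⟩
    refine ⟨true :: u, ?_⟩
    obtain ⟨j, rfl⟩ := List.isPrefixOf_iff_prefix.1 h
    rw [List.drop_left] at hu
    rw [hu, expand]
  · rintro ⟨_ | ⟨_ | _, u⟩, hu⟩ <;> simp [expand] at hu
    subst hu
    exact ⟨by simp, u, by simp⟩

/-- A mismatch clears the flag for good, but the scan goes on to the end so that all bits reach
`cur'` and `io` can be restored. The induction is on a bound for the length, since one round may
consume a whole copy of `w`. -/
theorem run_scanLoop (k : ℕ) (w : List Bool) :
    ∀ (f g : Bool) (i s c c' o d : List Bool), i.length ≤ k →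
      ∃ f', (f' = true ↔ f = true ∧ ∃ u, i = expand w u) ∧
        Run scanLoop ⟨i.head?, none, f, g⟩ (contents i s c w c' [] o d)
          ⟨none, none, f', g⟩ (contents [] s c w (i.reverse ++ c') [] o d)
          (k * (12 * w.length + 9) + 1) := by
  induction k with
  | zero =>
    intro f g i s c c' o d hi
    obtain rfl : i = [] := List.length_eq_zero_iff.1 (by omega)
    exact ⟨f, by simpa using fun _ => ⟨[], rfl⟩, run_congr (.loop_false rfl) rfl rfl (by simp)⟩
  | succ k ih =>
    rintro f g (_ | ⟨_ | _, i⟩) s c c' o d hi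
    · exact ⟨f, by simpa using fun _ => ⟨[], rfl⟩, run_congr (.loop_false rfl) rfl rfl (by simp)⟩
    · obtain ⟨f', hf', hr⟩ := ih f g i s c (false :: c') o d (by simpa using hi)
      refine ⟨f', ?_, run_congr (.loop_true rfl (run_scanStep_false ..) hr) rfl (by simp)
        (by simp only [Nat.add_mul]; omega)⟩
      rw [hf']
      refine and_congr_right fun _ => ⟨fun ⟨u, hu⟩ => ⟨false :: u, by rw [hu, expand]⟩, ?_⟩
      rintro ⟨_ | ⟨_ | _, u⟩, hu⟩ <;> simp [expand] at hu
      exact ⟨u, hu⟩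
    · obtain ⟨f', hf', hr⟩ := ih (f && w.isPrefixOf i) g (i.drop w.length) s c
        ((i.take w.length).reverse ++ true :: c') o d (by simp at hi ⊢; omega)
      refine ⟨f', ?_, run_congr (.loop_true rfl (run_scanStep_true ..) hr) rfl ?_
        (by simp only [Nat.add_mul]; omega)⟩
      · rw [hf', Bool.and_eq_true, and_assoc, isPrefixOf_and_exists_expand]
      · rw [← List.append_assoc, ← List.reverse_append, List.take_append_drop]
        simp

theorem run_scan (f g : Bool) (i s c w o d : List Bool) :
    ∃ f', (f' = true ↔ f = true ∧ ∃ u, i = expand w u) ∧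
      Run scan ⟨none, none, f, g⟩ (contents i s c w [] [] o d)
        ⟨none, none, f', g⟩ (contents i s c w [] [] o d)
        (i.length * (12 * w.length + 13) + 4) := by
  obtain ⟨f', hf', hr⟩ := run_scanLoop i.length w f g i s c [] o d le_rfl
  refine ⟨f', hf', run_congr (.seq (run_look io ⟨none, none, f, g⟩ (contents i s c w [] [] o d))
    (.seq hr (run_moveAll (by decide) ..))) rfl (by simp) ?_⟩
  simp [Nat.mul_add]
  omega

/-! ### Testing all right factors -/

/-- Tests whether the tree whose subtrees are on `cur` is a right factor, where the subtrees of
the root of the tree in question are on `cur` and `io`. -/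
def testFactor : Prog :=
  .seq (moveAll cur nxt) <| .seq (.load fun v => { v with flag := true }) <|
    .seq scan <| .seq (moveAll nxt cur)
      (.load fun v => { v with flag := false, found := v.found || v.flag })

/-- Moves one more subtree of the root from `io` to `cur`, and tests whether those on `cur` form a
right factor, unless none is left on `io`. -/
def factorStep : Prog :=
  .seq (moveTree io cur) <| .seq (look io) <| .seq
    (.ite (fun v => v.a = some true) testFactor (.load id)) (look io)

/-- Tests all the right factors. -/
def factorLoop : Prog := .loop (fun v => v.a = some true) factorStep

theorem run_testFactor (a : Option Bool) (g : Bool) (i w : List Bool) :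
    ∃ g', (g' = true ↔ g = true ∨ ∃ u, i = expand w u) ∧
      Run testFactor ⟨a, none, false, g⟩ (contents i [] w.reverse [] [] [] [] [])
        ⟨none, none, false, g'⟩ (contents i [] w.reverse [] [] [] [] [])
        (i.length * (12 * w.length + 13) + 8 * w.length + 10) := by
  obtain ⟨f', hf', hr⟩ := run_scan true g i [] [] w [] []
  refine ⟨g || f', by simp [hf'], ?_⟩
  have h₁ := run_moveAll (X := cur) (Y := nxt) (by decide) ⟨a, none, false, g⟩
    (contents i [] w.reverse [] [] [] [] [])
  simp only [contents_cur, contents_nxt, update_cur, update_nxt, List.reverse_reverse,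
    List.append_nil, List.length_reverse] at h₁
  have h₂ := run_moveAll (X := nxt) (Y := cur) (by decide) ⟨none, none, f', g⟩
    (contents i [] [] w [] [] [] [])
  simp only [contents_cur, contents_nxt, update_cur, update_nxt, List.append_nil] at h₂
  exact run_congr (.seq h₁ (.seq (.load ..) (.seq hr (.seq h₂ (.load ..))))) rfl rfl (by omega)

theorem run_factorStep (N : ℕ) (g : Bool) (b r : List OrderedTree) (t : OrderedTree)
    (hN : (codes b).length + (codes (t :: r)).length < N) :
    ∃ g', (g' = true ↔ g = true ∨ (r ≠ [] ∧ ∃ u, codes r ++ [false] =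
        expand (codes (b ++ [t])) u)) ∧
      Run factorStep ⟨some true, none, false, g⟩
        (contents (codes (t :: r) ++ [false]) [] (codes b).reverse [] [] [] [] [])
        ⟨(codes r ++ [false]).head?, none, false, g'⟩
        (contents (codes r ++ [false]) [] (codes (b ++ [t])).reverse [] [] [] [] [])
        (N * (12 * N + 13) + 14 * N + 15) := by
  have h₁ := run_moveTree_cur ⟨some true, none, false, g⟩ t (codes r ++ [false]) []
    (codes b).reverse [] [] [] []
  have e : t.code.reverse ++ (codes b).reverse = (codes (b ++ [t])).reverse := by simp
  rw [e] at h₁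
  simp only [codes_cons, List.append_assoc, List.length_append] at hN ⊢
  rcases r with _ | ⟨u, r⟩
  -- With no subtree left on `io` the right factor would be the whole tree, so no test is made.
  · exact ⟨g, by simp, run_congr (.seq h₁ (.seq (run_look ..) (.seq (.ite_false rfl (.load ..))
      (run_look ..)))) rfl (by simp) (by simp at hN; nlinarith)⟩
  · obtain ⟨g', hg', hr⟩ := run_testFactor (some true) g (codes (u :: r) ++ [false])
      (codes (b ++ [t]))
    have hhead : (codes (u :: r) ++ [false]).head? = some true := by
      cases u; simp [code_node]
    have h₂ := run_look io ⟨none, none, false, g⟩ (contents (codes (u :: r) ++ [false]) []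
      (codes (b ++ [t])).reverse [] [] [] [] [])
    simp only [contents_io, hhead] at h₂
    refine ⟨g', by simpa using hg', run_congr (.seq h₁ (.seq h₂ (.seq (.ite_true rfl hr)
      (run_look ..)))) rfl rfl ?_⟩
    have hle : (codes (u :: r) ++ [false]).length * (12 * (codes (b ++ [t])).length + 13) ≤
        N * (12 * N + 13) := by
      refine Nat.mul_le_mul ?_ ?_
      · simp only [List.length_append, List.length_singleton]; omega
      · simp only [codes_append, codes_cons, codes_nil, List.append_nil, List.length_append]; omega
    simp only [codes_append, codes_cons, codes_nil, List.append_nil, List.length_append] at hN hle ⊢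
    omega

/-- The prefix `b` has already been shifted to `cur`; each split of `r` either comes right after its
first tree, tested in this round, or later, and is covered by the induction. -/
theorem run_factorLoop (N : ℕ) (r : List OrderedTree) :
    ∀ (g : Bool) (b : List OrderedTree), (codes b).length + (codes r).length < N →
      ∃ g', (g' = true ↔ g = true ∨ ∃ b' r', r = b' ++ r' ∧ b' ≠ [] ∧ r' ≠ [] ∧
          ∃ u, codes r' ++ [false] = expand (codes (b ++ b')) u) ∧
        Run factorLoop ⟨(codes r ++ [false]).head?, none, false, g⟩
          (contents (codes r ++ [false]) [] (codes b).reverse [] [] [] [] [])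
          ⟨some false, none, false, g'⟩
          (contents [false] [] (codes (b ++ r)).reverse [] [] [] [] [])
          (r.length * (N * (12 * N + 13) + 14 * N + 16) + 1) := by
  induction r with
  | nil =>
    intro g b hN
    refine ⟨g, ?_, run_congr (.loop_false rfl) rfl (by simp) (by simp)⟩
    simp only [iff_self_or]
    rintro ⟨b', r', h, hb, -⟩
    simp_all
  | cons t r ih =>
    intro g b hN
    obtain ⟨g₁, hg₁, h₁⟩ := run_factorStep N g b r t hN
    obtain ⟨g₂, hg₂, h₂⟩ := ih g₁ (b ++ [t]) (by simp at hN ⊢; omega)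
    refine ⟨g₂, ?_, ?_⟩
    · rw [hg₂, hg₁, or_assoc]
      refine or_congr_right ⟨?_, ?_⟩
      · rintro (⟨hr, hu⟩ | ⟨b', r', rfl, hb, hr, hu⟩)
        · exact ⟨[t], r, rfl, by simp, hr, hu⟩
        · exact ⟨t :: b', r', rfl, by simp, hr, by simpa using hu⟩
      · rintro ⟨_ | ⟨s, b'⟩, r', h, hb, hr, hu⟩
        · exact absurd rfl hb
        · simp only [List.cons_append, List.cons.injEq] at h
          obtain ⟨rfl, rfl⟩ := h
          rcases b' with _ | ⟨s, b'⟩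
          · exact Or.inl ⟨hr, hu⟩
          · exact Or.inr ⟨s :: b', r', rfl, by simp, hr, by simpa using hu⟩
    · have hhead : (codes (t :: r) ++ [false]).head? = some true := by
        cases t; simp [code_node]
      rw [hhead]
      refine run_congr (.loop_true (by simp) h₁ h₂) rfl (by simp) ?_
      simp only [List.length_cons, Nat.add_mul]
      omega

/-! ### The decision procedure and its running time -/

/-- Decides mult-primality of the tree on `io`. -/
def decidePrime : Prog :=
  .seq canonicalize <| .seq (take io) <| .seq (look io) <| .seq factorLoop <|
    .seq (clear io) <| .seq (clear cur) <| .seq (.push io fun v => !v.found)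
      (.load fun _ => ⟨none, none, false, false⟩)

theorem run_decidePrime (t : OrderedTree) :
    ∃ answer : Bool, (answer = true ↔ (UnorderedTree.ofOrdered t).MultPrime) ∧
      Run decidePrime ⟨none, none, false, false⟩ (contents t.code [] [] [] [] [] [] [])
        ⟨none, none, false, false⟩ (contents [answer] [] [] [] [] [] [] [])
        (1000 * t.numVertices ^ 3) := by
  obtain ⟨N, hN⟩ : ∃ N, t.code.length = N := ⟨_, rfl⟩
  have h₁ := run_canonicalize ⟨none, none, false, false⟩ rfl t N hN
  obtain ⟨r, hr⟩ : ∃ r, canon t = node r := ⟨_, (node_subtrees _).symm⟩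
  have hlen := length_code_canon t
  rw [hr, code_node] at hlen
  simp only [List.length_cons, List.length_append, List.length_nil, hN] at hlen
  obtain ⟨g, hg, h₂⟩ := run_factorLoop N r false [] (by simp; omega)
  rw [hr, code_node] at h₁
  simp only [codes_nil, List.reverse_nil, List.nil_append] at h₂
  refine ⟨!g, ?_, ?_⟩
  · rw [Bool.not_eq_true', ← Bool.not_eq_true, hg, ← not_iff_not, not_not,
      UnorderedTree.not_multPrime_iff, hr]
    simp only [Bool.false_eq_true, false_or, List.nil_append, OrderedTree.subtrees]
    constructor
    · rintro ⟨b, r', h, hb, hr', hu⟩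
      exact ⟨b, r', hb, hr', h, hu⟩
    · rintro ⟨b, r', hb, hr', h, hu⟩
      exact ⟨b, r', h, hb, hr', hu⟩
  · have h₀ := run_take io ⟨none, none, false, false⟩
      (contents (true :: (codes r ++ [false])) [] [] [] [] [] [] [])
    simp only [contents_io, update_io, List.head?_cons, List.tail_cons] at h₀
    refine run_congr (.seq h₁ (.seq h₀ (.seq (run_look io ⟨some true, none, false, false⟩
      (contents (codes r ++ [false]) [] [] [] [] [] [] [])) (.seq h₂ (.seq (run_clear ..)
      (.seq (run_clear ..) (.seq (.push ..) (.load ..)))))))) rfl (by simp) ?_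
    have hrN : r.length * (N * (12 * N + 13) + 14 * N + 16) ≤
        N * (N * (12 * N + 13) + 14 * N + 16) :=
      Nat.mul_le_mul_right _ ((length_le_length_codes r).trans (by omega))
    have hn : 1 ≤ t.numVertices := by cases t; simp [numVertices]
    rw [length_code] at hN
    generalize t.numVertices = n at *
    subst hN
    -- With `N = 2 * n`, the cubic terms `18 * N ^ 3` of sorting and `12 * N ^ 3` of testing give
    -- `240 * n ^ 3`; the lower-order terms are absorbed through these two inequalities, within the
    -- constant `1000`.
    have h₁ : n ≤ n ^ 3 := Nat.le_self_pow (by norm_num) n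
    have h₂ : n ^ 2 ≤ n ^ 3 := Nat.pow_le_pow_right hn (by norm_num)
    simp only [update_io, contents_io, contents_cur, List.length_reverse, List.length_singleton]
    ring_nf at hrN ⊢
    omega

/-- The machine that decides mult-primality. -/
noncomputable def decidePrimeMachine : Turing.TM2ComputableAux Bool Bool where
  tm := machine decidePrime io ⟨none, none, false, false⟩
  inputAlphabet := Equiv.refl Bool
  outputAlphabet := Equiv.refl Bool

end PrimalityStack

open PrimalityStack in
theorem mainTheorem2 :
    ∃ (M : Turing.TM2ComputableAux Bool Bool) (C : ℕ),
      (∀ k : M.tm.K, Finite (M.tm.Γ k)) ∧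
      ∀ T : UnorderedTree, 1 < T.numVertices →
        ∃ answer : Bool, (answer = true ↔ T.MultPrime) ∧
          ∀ w : List Bool, T.IsRepresentedBy w →
            Nonempty (Turing.TM2OutputsInTime M.tm
              (w.map M.inputAlphabet.symm)
              (some ([answer].map M.outputAlphabet.symm))
              (C * T.numVertices ^ 4)) := by
  classical
  refine ⟨decidePrimeMachine, 1001, fun k => inferInstanceAs (Finite Bool), fun T hT =>
    ⟨decide T.MultPrime, by simp, ?_⟩⟩
  rintro w ⟨t, rfl, rfl⟩
  obtain ⟨answer, ha, h⟩ := run_decidePrime t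
  obtain rfl : decide (UnorderedTree.ofOrdered t).MultPrime = answer := by
    rw [Bool.eq_iff_iff, ha, decide_eq_true_iff]
  have hn : (UnorderedTree.ofOrdered t).numVertices = t.numVertices := rfl
  rw [hn] at hT ⊢
  rw [← update_empty, ← update_empty] at h
  -- One step is held back for the halting step that `machine_outputs` adds; the constant `1001`
  -- leaves room for it.
  obtain ⟨h'⟩ := StackProg.machine_outputs (k := io) (h.mono (n := 1001 * t.numVertices ^ 4 - 1) (by
    have h₁ : t.numVertices ^ 3 ≤ t.numVertices ^ 4 := Nat.pow_le_pow_right hT.le (by norm_num)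
    have h₂ : 1 ≤ t.numVertices ^ 4 := Nat.one_le_pow _ _ (by omega)
    omega))
  have e : 1001 * t.numVertices ^ 4 - 1 + 1 = 1001 * t.numVertices ^ 4 := by
    have h₂ : 1 ≤ t.numVertices ^ 4 := Nat.one_le_pow _ _ (by omega)
    omega
  rw [e] at h'
  have ew : t.code.map decidePrimeMachine.inputAlphabet.symm = t.code := List.map_id _
  rw [ew]
  exact ⟨h'⟩
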